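/- **Conventions.** For a set of ordinals $A$, let $\mathrm{ssup}(A)=\sup\{\alpha+1\mid\alpha\in A\}$ and $\mathrm{acc}(A)=\{\alpha\in A\mid \sup(A\cap\alpha)=\alpha>0\}$. For infinite cardinals $\theta<\kappa$, $E^\kappa_{\theta}$ and $E^\kappa_{\ne\theta}$ are the sets of $\alpha<\kappa$ with $\mathrm{cf}(\alpha)=\theta$, respectively $\mathrm{cf}(\alpha)\neq\theta$. $[X]^{\mu}$ is the set of all subsets of $X$ of cardinality $\mu$. A set $\mathcal C\subseteq[X]^{\aleph_0}$ is club if it is $\subseteq$-cofinal in $[X]^{\aleph_0}$ and closed under unions of $\subseteq$-increasing $\omega$-chains; $S\subseteq[X]^{\aleph_0}$ is stationary in $[X]^{\aleph_0}$ if it meets every such club. **Weak indexed square.** $\boxminus^{\mathrm{ind}}(\kappa,\theta)$ asserts that there are a set $\Gamma$, ordinals $i(\alpha)$ $(\alpha\in\Gamma)$ and a matrix $\langle C_{\alpha,i}\mid \alpha\in\Gamma,\ i(\alpha)\le i<\theta\rangle$ such that: 1. $E^\kappa_{\neq\theta}\cap\mathrm{acc}(\kappa)\subseteq\Gamma\subseteq\mathrm{acc}(\kappa)$;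 2. for all $\alpha\in\Gamma$, $i(\alpha)<\theta$, and $\langle C_{\alpha,i}\mid i(\alpha)\le i<\theta\rangle$ is a $\subseteq$-increasing sequence of clubs in $\alpha$ with $\Gamma\cap\alpha=\bigcup_{i(\alpha)\le i<\theta}\mathrm{acc}(C_{\alpha,i})$; 3. for all $\alpha\in\Gamma$, $i(\alpha)\le i<\theta$ and $\bar\alpha\in\mathrm{acc}(C_{\alpha,i})$, we have $i(\bar\alpha)\le i$ and $C_{\bar\alpha,i}=C_{\alpha,i}\cap\bar\alpha$; 4. for every club $D$ in $\kappa$ there is $\alpha\in\mathrm{acc}(D)\cap\Gamma$ such that $D\cap\alpha\ne C_{\alpha,i}$ for all $i$ with $i(\alpha)\le i<\theta$. **Semi-Stationary Reflection.** For a regular cardinal $\lambda\ge\omega_2$ and $x,y\in[\lambda]^{\aleph_0}$, write $x\sqsubseteq^* y$ iff $x\subseteq y$, $x\cap\omega_1=y\cap\omega_1$, $\mathrm{ssup}(x)=\mathrm{ssup}(y)$, and $\mathrm{ssup}(x\cap\gamma)=\mathrm{ssup}(y\cap\gamma)$ for every $\gamma\in x\cap E^\lambda_{\omega_1}$. $\mathsf{SSR}$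 asserts that for every regular cardinal $\lambda\geq\omega_2$ and every stationary $S\subseteq[\lambda]^{\aleph_0}$ that is closed upwards under $\sqsubseteq^*$, there is $W\in[\lambda]^{\aleph_1}$ with $W\supseteq\omega_1$ such that $S\cap[W]^{\aleph_0}$ is stationary in $[W]^{\aleph_0}$. **Martin's Maximum.** $\mathsf{MM}$ asserts that for every (nonempty) forcing notion $P$ that preserves stationary subsets of $\omega_1$ and every family of at most $\aleph_1$ dense subsets of $P$, there is a filter on $P$ meeting every member of the family. **Theorem.** 1. $\mathsf{SSR}$ implies that $\boxminus^{\mathrm{ind}}(\kappa,\omega_1)$ fails for every regular cardinal $\kappa\ge\omega_2$. 2. $\mathsf{MM}$ implies $\mathsf{SSR}$; consequently $\mathsf{MM}$ implies that $\boxminus^{\mathrm{ind}}(\kappa,\omega_1)$ fails for every regular cardinal $\kappa>\omega_1$. -/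

import Mathlib

open Cardinal Ordinal Set

universe u

/-! ### Sets of ordinals -/

/-- The strong supremum `ssup A = sup {α + 1 | α ∈ A}` of a (bounded) set of ordinals. -/
noncomputable def ssup (A : Set Ordinal.{u}) : Ordinal.{u} :=
  sSup (Order.succ '' A)

/-- `acc A = {α ∈ A | sup (A ∩ α) = α > 0}`, the accumulation points of `A` lying in `A`. -/
def acc (A : Set Ordinal.{u}) : Set Ordinal.{u} :=
  {α | α ∈ A ∧ sSup (A ∩ Iio α) = α ∧ 0 < α}

/-- `C` is a club (closed unbounded) subset of the ordinal `α`. -/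
def IsClubIn (C : Set Ordinal.{u}) (α : Ordinal.{u}) : Prop :=
  C ⊆ Iio α ∧ IsClub (Subtype.val ⁻¹' C : Set (Iio α))

/-! ### Indexed squares -/

/-- `⟨C α i | α ∈ Γ, idx α ≤ i < θ⟩` is a matrix witnessing the weak indexed square principle
at `κ` and `θ`. The values of `idx` outside `Γ`, and those of `C` outside the index set of
the matrix, play no role. -/
structure IsWeakIndexedSquareSeq (κ θ : Cardinal.{u}) (Γ : Set Ordinal.{u})
    (idx : Ordinal.{u} → Ordinal.{u}) (C : Ordinal.{u} → Ordinal.{u} → Set Ordinal.{u}) :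
    Prop where
  subset_index : {α | α < κ.ord ∧ α.cof ≠ θ} ∩ acc (Iio κ.ord) ⊆ Γ
  index_subset : Γ ⊆ acc (Iio κ.ord)
  idx_lt : ∀ α ∈ Γ, idx α < θ.ord
  club : ∀ α ∈ Γ, ∀ i ∈ Ico (idx α) θ.ord, IsClubIn (C α i) α
  increasing : ∀ α ∈ Γ, ∀ i ∈ Ico (idx α) θ.ord, ∀ j ∈ Ico (idx α) θ.ord,
    i ≤ j → C α i ⊆ C α j
  cover : ∀ α ∈ Γ, Γ ∩ Iio α = ⋃ i ∈ Ico (idx α) θ.ord, acc (C α i)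
  coherent : ∀ α ∈ Γ, ∀ i ∈ Ico (idx α) θ.ord, ∀ β ∈ acc (C α i),
    idx β ≤ i ∧ C β i = C α i ∩ Iio β
  nontrivial : ∀ D : Set Ordinal.{u}, IsClubIn D κ.ord →
    ∃ α ∈ acc D ∩ Γ, ∀ i ∈ Ico (idx α) θ.ord, D ∩ Iio α ≠ C α i

/-- The weak indexed square principle at `κ` and `θ`. -/
def WeakIndexedSquare (κ θ : Cardinal.{u}) : Prop :=
  ∃ (Γ : Set Ordinal.{u}) (idx : Ordinal.{u} → Ordinal.{u})
    (C : Ordinal.{u} → Ordinal.{u} → Set Ordinal.{u}), IsWeakIndexedSquareSeq κ θ Γ idx C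

/-! ### Stationary families of countable sets and semi-stationary reflection -/

/-- `[X]^ℵ₀`, the family of all subsets of `X` of cardinality `ℵ₀`. -/
def countableSubsets {A : Type*} (X : Set A) : Set (Set A) :=
  {x | x ⊆ X ∧ #x = ℵ₀}

/-- `𝒞` is a club in `[X]^ℵ₀`: it is cofinal with respect to inclusion and closed under
unions of increasing `ω`-chains. -/
structure IsClubFamily {A : Type*} (X : Set A) (𝒞 : Set (Set A)) : Prop where
  subset : 𝒞 ⊆ countableSubsets X
  cofinal : ∀ x ∈ countableSubsets X, ∃ y ∈ 𝒞, x ⊆ y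
  closed : ∀ f : ℕ → Set A, Monotone f → (∀ n, f n ∈ 𝒞) → (⋃ n, f n) ∈ 𝒞

/-- `S` is a stationary subset of `[X]^ℵ₀`. -/
def IsStationaryFamily {A : Type*} (X : Set A) (S : Set (Set A)) : Prop :=
  S ⊆ countableSubsets X ∧ ∀ 𝒞, IsClubFamily X 𝒞 → (S ∩ 𝒞).Nonempty

/-- The relation `x ⊑* y` between countable sets of ordinals. -/
structure StarExtends (x y : Set Ordinal.{u}) : Prop where
  subset : x ⊆ y
  inter_omega_one : x ∩ Iio (ω_ 1) = y ∩ Iio (ω_ 1)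
  ssup_eq : ssup x = ssup y
  ssup_inter_eq : ∀ γ ∈ x, γ.cof = ℵ_ 1 → ssup (x ∩ Iio γ) = ssup (y ∩ Iio γ)

/-- The Semi-Stationary Reflection principle (in the universe `Type u`). -/
def SSR : Prop :=
  ∀ μ : Cardinal.{u}, μ.IsRegular → ℵ_ 2 ≤ μ →
    ∀ S : Set (Set Ordinal.{u}), IsStationaryFamily (Iio μ.ord) S →
      (∀ x ∈ S, ∀ y ∈ countableSubsets (Iio μ.ord), StarExtends x y → y ∈ S) →
      ∃ W : Set Ordinal.{u}, W ⊆ Iio μ.ord ∧ #W = ℵ_ 1 ∧ Iio (ω_ 1) ⊆ W ∧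
        IsStationaryFamily W (S ∩ countableSubsets W)

/-! ### Martin's Maximum

Smaller conditions are stronger. A map `A : ω₁ → Set P` stands for the nice `P`-name
`{(α̌, s) | s ∈ A α}` of a subset of the ground model's `ω₁`; every subset of it in a generic
extension by `P` has such a name. -/

section Forcing

/-- `p ⊩ α̌ ∈ Ȧ`. -/
def ForcesMem {P : Type u} [Preorder P] (p : P) (α : Iio (ω_ 1 : Ordinal.{u}))
    (A : Iio (ω_ 1 : Ordinal.{u}) → Set P) : Prop :=
  ∀ q ≤ p, ∃ r ≤ q, ∃ s ∈ A α, r ≤ s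

/-- `p ⊩ "Ȧ is unbounded in δ̌"`. -/
def ForcesUnboundedBelow {P : Type u} [Preorder P] (p : P) (δ : Iio (ω_ 1 : Ordinal.{u}))
    (A : Iio (ω_ 1 : Ordinal.{u}) → Set P) : Prop :=
  ∀ α < δ, ∀ q ≤ p, ∃ r ≤ q, ∃ β, α < β ∧ β < δ ∧ ForcesMem r β A

/-- `p ⊩ "Ȧ is a club in ω̌₁"`: the name is forced to be unbounded and to contain each limit
ordinal below `ω₁` in which it is unbounded. -/
structure ForcesClub {P : Type u} [Preorder P] (p : P)
    (A : Iio (ω_ 1 : Ordinal.{u}) → Set P) : Prop where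
  unbounded : ∀ α, ∀ q ≤ p, ∃ r ≤ q, ∃ β, α < β ∧ ForcesMem r β A
  closed : ∀ δ, Order.IsSuccLimit δ → ∀ q ≤ p, ForcesUnboundedBelow q δ A → ForcesMem q δ A

/-- Every condition of `P` forces that `Š` is a stationary subset of `ω̌₁`. -/
def ForcesStationary (P : Type u) [Preorder P] (S : Set (Iio (ω_ 1 : Ordinal.{u}))) : Prop :=
  ∀ (p : P) (A : Iio (ω_ 1 : Ordinal.{u}) → Set P), ForcesClub p A →
    ∃ q ≤ p, ∃ α ∈ S, ForcesMem q α A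

/-- Forcing with `P` preserves stationary subsets of `ω₁`. -/
def PreservesStationary (P : Type u) [Preorder P] : Prop :=
  ∀ S : Set (Iio (ω_ 1 : Ordinal.{u})), IsStationary S → ForcesStationary P S

/-- Martin's Maximum (in the universe `Type u`): if `P` is a forcing notion preserving
stationary subsets of `ω₁`, then for each family of at most `ℵ₁` dense subsets of `P`, some
filter on `P` meets all of them. -/
def MartinsMaximum : Prop :=
  ∀ (P : Type u) [Preorder P] [Nonempty P], PreservesStationary P →
    ∀ 𝒟 : Set (Set P), #𝒟 ≤ ℵ_ 1 → (∀ D ∈ 𝒟, ∀ p : P, ∃ q ∈ D, q ≤ p) →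
      ∃ G : Order.PFilter P, ∀ D ∈ 𝒟, ∃ p ∈ D, p ∈ G

end Forcing

/-! For β < α in Γ let c(β,α) be the least i with β ∈ acc(C_{α,i}); `Rel idx C i β α` expresses
c(β,α) ≤ i. Coherence makes c subadditive (`Rel.of_rel`), closedness of the clubs makes it
continuous (`Rel.of_forall`), and clause 4 forbids an unbounded set on whose pairs c is bounded by a
fixed i < θ (`not_forall_rel`).

Part 1 uses the family S of countable x with trace δ on ω₁ such that c(ssup(x∩γ), ssup x) > δ for
some γ ∈ x of cofinality ω₁. It cannot reflect to a W of size ℵ₁: take ε ∈ Γ above W. Club many x ⊆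
W contain enough colours that c(ssup(x∩γ), ε) and c(ssup x, ε) are at most δ, and subadditivity
bounds the remaining colour. The family is stationary: if a club missed it, a game would yield one δ
< ω₁ and unboundedly many ρ such that any two of them, ρ < ρ', lie in closed sets x, y with trace δ
and common supremum ε. Since ρ+δ = ssup(x∩(ρ+ω₁)) and x, y are not in S, both c(ρ+δ, ε) and c(ρ'+δ,
ε) are at most δ. Hence so is c(ρ+δ, ρ'+δ), against clause 4.

Part 2 goes through strong reflection. Forcing with closed chains through a projective stationary
family preserves stationary subsets of ω₁, so MM yields a continuous chain of length ω₁. Apply this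
to the models that lie in S whenever some enlargement with the same trace on ω₁ does: the given
stationary family then reflects to the union of the chain. -/

/-! ### Closure under set-valued operations on finite sets -/

section Closure

variable {A : Type*}

/-- `y` is closed under the operation `G`, which sends finite sets to sets. -/
def ClosedUnder (G : Finset A → Set A) (y : Set A) : Prop :=
  ∀ e : Finset A, ↑e ⊆ y → G e ⊆ y

/-- The least superset of `s` that is closed under `G`. -/
def opClosure (G : Finset A → Set A) (s : Set A) : Set A :=
  ⋂₀ {y | s ⊆ y ∧ ClosedUnder G y}

variable {G : Finset A → Set A} {s t y : Set A}

theorem subset_opClosure : s ⊆ opClosure G s :=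
  subset_sInter fun _ h => h.1

theorem opClosure_subset (h : s ⊆ y) (hy : ClosedUnder G y) : opClosure G s ⊆ y :=
  sInter_subset_of_mem ⟨h, hy⟩

theorem closedUnder_opClosure : ClosedUnder G (opClosure G s) := fun e he =>
  subset_sInter fun _ hy => hy.2 e (he.trans (sInter_subset_of_mem hy))

theorem opClosure_mono (h : s ⊆ t) : opClosure G s ⊆ opClosure G t :=
  opClosure_subset (h.trans subset_opClosure) closedUnder_opClosure

theorem ClosedUnder.mono {H : Finset A → Set A} (hy : ClosedUnder G y) (h : ∀ e, H e ⊆ G e) :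
    ClosedUnder H y := fun e he => (h e).trans (hy e he)

theorem Set.Countable.setOf_finset_subset (hs : s.Countable) :
    {e : Finset A | (e : Set A) ⊆ s}.Countable := by
  refine ((countable_ofPred_finite_subset hs).preimage (f := ((↑) : Finset A → Set A))
    Finset.coe_injective).mono fun e he => ?_
  exact ⟨e.finite_toSet, he⟩

theorem Set.Countable.opClosure (hG : ∀ e, (G e).Countable) (hs : s.Countable) :
    (opClosure G s).Countable := by
  let c : ℕ → Set A := Nat.rec s fun _ c => c ∪ ⋃ e ∈ {e : Finset A | (e : Set A) ⊆ c}, G e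
  have hsucc : ∀ n, c (n + 1) = c n ∪ ⋃ e ∈ {e : Finset A | (e : Set A) ⊆ c n}, G e :=
    fun n => rfl
  have hmono : Monotone c := monotone_nat_of_le_succ fun n => by
    rw [hsucc]; exact subset_union_left
  have hc : ∀ n, (c n).Countable := by
    intro n
    induction n with
    | zero => exact hs
    | succ n ih =>
      rw [hsucc]
      exact ih.union (ih.setOf_finset_subset.biUnion fun e _ => hG e)
  refine (countable_iUnion hc).mono (opClosure_subset (subset_iUnion c 0) fun e he => ?_)
  obtain ⟨n, hn⟩ : ∃ n, (e : Set A) ⊆ c n :=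
    hmono.directed_le.exists_mem_subset_of_finset_subset_biUnion he
  refine Subset.trans ?_ (subset_iUnion c (n + 1))
  rw [hsucc]
  exact (subset_biUnion_of_mem (u := fun e => G e) hn).trans subset_union_right

theorem mem_opClosure_iff_finite {a : A} :
    a ∈ opClosure G s ↔ ∃ e : Finset A, ↑e ⊆ s ∧ a ∈ opClosure G (e : Set A) := by
  classical
  refine ⟨fun ha => ?_, fun ⟨e, he, ha⟩ => opClosure_mono he ha⟩
  refine opClosure_subset (y := {a | ∃ e : Finset A, ↑e ⊆ s ∧ a ∈ opClosure G (e : Set A)})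
    (fun a ha => ⟨{a}, by simpa using ha, subset_opClosure (by simp)⟩) (fun e he a ha => ?_) ha
  choose! f hf hf' using he
  refine ⟨e.biUnion f, by simpa using fun i hi => hf hi, ?_⟩
  refine closedUnder_opClosure e (fun b hb => opClosure_mono ?_ (hf' hb)) ha
  exact_mod_cast Finset.subset_biUnion_of_mem f hb

theorem mem_countableSubsets {X x : Set A} :
    x ∈ countableSubsets X ↔ x ⊆ X ∧ x.Countable ∧ x.Infinite := by
  rw [countableSubsets, mem_ofPred_eq, le_antisymm_iff, le_aleph0_iff_set_countable,
    ← Cardinal.infinite_iff, infinite_coe_iff]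

/-- Every club of countable subsets of an infinite set contains all countable sets closed under
a suitable operation. -/
theorem IsClubFamily.exists_closedUnder {X : Set A} {𝒞 : Set (Set A)} (hX : X.Infinite)
    (h𝒞 : IsClubFamily X 𝒞) :
    ∃ G : Finset A → Set A, (∀ e, (G e).Countable) ∧ (∀ e, G e ⊆ X) ∧
      ∀ y ⊆ X, y.Countable → ClosedUnder G y → y ∈ 𝒞 := by
  classical
  have hch : ∀ s : Set A, ∃ c : Set A, s ⊆ X → s.Countable → c ∈ 𝒞 ∧ s ⊆ c := by
    intro s
    by_cases hs : s ⊆ X ∧ s.Countable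
    · obtain ⟨z, hzX, hz⟩ := Cardinal.le_mk_iff_exists_subset.1
        ((Cardinal.infinite_iff).1 hX.to_subtype)
      have hz' := mem_countableSubsets.1 (show z ∈ countableSubsets X from ⟨hzX, hz⟩)
      obtain ⟨c, hc, hsc⟩ := h𝒞.cofinal (s ∪ z) (mem_countableSubsets.2
        ⟨union_subset hs.1 hzX, hs.2.union hz'.2.1, hz'.2.2.mono subset_union_right⟩)
      exact ⟨c, fun _ _ => ⟨hc, subset_union_left.trans hsc⟩⟩
    · exact ⟨∅, fun h h' => (hs ⟨h, h'⟩).elim⟩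
  choose ch hch using hch
  -- Recursion along proper subsets makes F monotone on finite subsets of X, with e ⊆ F e ∈ 𝒞.
  let F : Finset A → Set A :=
    Finset.strongInduction fun e ih => ch (↑e ∪ ⋃ t, ⋃ h : t ⊂ e, ih t h)
  have hF : ∀ e, F e = ch (↑e ∪ ⋃ t, ⋃ _ : t ⊂ e, F t) := fun e => Finset.strongInduction_eq _ e
  have hmem : ∀ e : Finset A, ↑e ⊆ X → F e ∈ 𝒞 ∧ (↑e ∪ ⋃ t, ⋃ _ : t ⊂ e, F t) ⊆ F e := by
    intro e
    induction e using Finset.strongInduction with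
    | H e ih =>
    intro he
    have ih' : ∀ t ⊂ e, F t ⊆ X ∧ (F t).Countable := fun t ht => by
      have := mem_countableSubsets.1 (h𝒞.subset (ih t ht
        ((Finset.coe_subset.2 ht.subset).trans he)).1)
      exact ⟨this.1, this.2.1⟩
    conv => enter [1]; rw [hF]
    conv => enter [2, 2]; rw [hF]
    refine hch _ (union_subset he (iUnion₂_subset fun t ht => (ih' t ht).1)) ?_
    refine e.countable_toSet.union ?_
    have : {t | t ⊂ e}.Countable := by
      refine (Finset.finite_toSet e.ssubsets).countable.mono fun t ht => ?_
      simpa using ht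
    exact this.biUnion fun t ht => (ih' t ht).2
  have hprop : ∀ e : Finset A, ↑e ⊆ X → F e ⊆ X ∧ (F e).Countable ∧ (F e).Infinite := fun e he =>
    mem_countableSubsets.1 (h𝒞.subset (hmem e he).1)
  refine ⟨fun e => if ↑e ⊆ X then F e else ∅, fun e => ?_, fun e => ?_, fun y hyX hyc hy => ?_⟩
  · dsimp only
    split_ifs with he
    exacts [(hprop e he).2.1, countable_empty]
  · dsimp only
    split_ifs with he
    exacts [(hprop e he).1, empty_subset _]
  have hy' : ∀ e : Finset A, ↑e ⊆ y → F e ⊆ y := fun e he => by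
    have := hy e he
    simpa only [if_pos (he.trans hyX)] using this
  have hne : y.Nonempty :=
    ((hprop ∅ (by simp)).2.2.nonempty).mono (hy' ∅ (by simp))
  obtain ⟨a, rfl⟩ := hyc.exists_eq_range hne
  -- The values of F at the initial segments of an enumeration of y form an ω-chain in 𝒞 with union
  -- y.
  let d : ℕ → Finset A := fun n => (Finset.range n).image a
  have hdy : ∀ n, (d n : Set A) ⊆ range a := fun n => by
    simp only [d, Finset.coe_image]; exact image_subset_range _ _
  have hmono : Monotone fun n => F (d n) := by
    refine monotone_nat_of_le_succ fun n => ?_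
    have hsub : d n ⊆ d (n + 1) := Finset.image_subset_image (Finset.range_subset_range.2 n.le_succ)
    rcases hsub.eq_or_ssubset with h | h
    · rw [h]
    · refine Subset.trans ?_ (hmem (d (n + 1)) ((hdy _).trans hyX)).2
      exact (subset_iUnion₂ (s := fun t (_ : t ⊂ d (n + 1)) => F t) (d n) h).trans
        subset_union_right
  have := h𝒞.closed _ hmono fun n => (hmem (d n) ((hdy n).trans hyX)).1
  convert this using 1
  refine Subset.antisymm ?_ (iUnion_subset fun n => hy' _ (hdy n))
  rintro _ ⟨n, rfl⟩
  refine mem_iUnion.2 ⟨n + 1, (hmem _ ((hdy (n + 1)).trans hyX)).2 (Or.inl ?_)⟩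
  simp only [d, Finset.coe_image]
  exact ⟨n, by simp, rfl⟩

/-- The countable sets closed under an operation form a club. -/
theorem isClubFamily_closedUnder {X : Set A} (hG : ∀ e, (G e).Countable)
    (hGX : ∀ e, G e ⊆ X) : IsClubFamily X {y ∈ countableSubsets X | ClosedUnder G y} where
  subset := fun _ h => h.1
  cofinal := fun x hx => by
    obtain ⟨hxX, hxc, hxi⟩ := mem_countableSubsets.1 hx
    exact ⟨opClosure G x, ⟨mem_countableSubsets.2 ⟨opClosure_subset hxX fun e _ => hGX e,
      hxc.opClosure hG, hxi.mono subset_opClosure⟩, closedUnder_opClosure⟩, subset_opClosure⟩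
  closed := fun f hf hfC => by
    refine ⟨mem_countableSubsets.2 ⟨iUnion_subset fun n => (hfC n).1.1, countable_iUnion fun n =>
      (mem_countableSubsets.1 (hfC n).1).2.1, (mem_countableSubsets.1 (hfC 0).1).2.2.mono
      (subset_iUnion f 0)⟩, fun e he => ?_⟩
    obtain ⟨n, hn⟩ : ∃ n, (e : Set A) ⊆ f n :=
      hf.directed_le.exists_mem_subset_of_finset_subset_biUnion he
    exact ((hfC n).2 e hn).trans (subset_iUnion f n)

theorem IsStationaryFamily.exists_closedUnder {X : Set A} {S : Set (Set A)}
    (hS : IsStationaryFamily X S) (hG : ∀ e, (G e).Countable) :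
    ∃ y ∈ S, ClosedUnder (fun e => G e ∩ X) y := by
  obtain ⟨y, hyS, -, hy⟩ := hS.2 _ (isClubFamily_closedUnder
    (fun e => (hG e).mono inter_subset_left) fun e => inter_subset_right)
  exact ⟨y, hyS, hy⟩

/-- The family `S` meets each club of countable sets; compare `IsStationaryFamily`. -/
def OpStationary (S : Set (Set A)) : Prop :=
  ∀ G : Finset A → Set A, (∀ e, (G e).Countable) → ∃ y ∈ S, y.Countable ∧ ClosedUnder G y

/-- Stationarity lifts to a larger set: closure is finitary, so an operation on B induces one on A,
and the B-closure of a set closed under the latter adds no new elements of A. -/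
theorem OpStationary.preimage {B : Type*} {S : Set (Set A)} (hS : OpStationary S) {j : A → B}
    (hj : Function.Injective j) : OpStationary {M : Set B | j ⁻¹' M ∈ S} := by
  classical
  intro G hG
  obtain ⟨y, hyS, hyc, hy⟩ := hS (fun e => j ⁻¹' opClosure G (j '' e)) fun e =>
    ((e.countable_toSet.image j).opClosure hG).preimage hj
  refine ⟨opClosure G (j '' y), ?_, (hyc.image j).opClosure hG, closedUnder_opClosure⟩
  suffices h : j ⁻¹' opClosure G (j '' y) = y by rwa [mem_ofPred_eq, h]
  refine Subset.antisymm (fun a ha => ?_) fun a ha => subset_opClosure (mem_image_of_mem j ha)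
  obtain ⟨e', he', ha⟩ := mem_opClosure_iff_finite.1 ha
  obtain ⟨e, hey, rfl⟩ := Finset.subset_set_image_iff.1 he'
  exact hy e hey (by simpa using ha)

end Closure

/-! ### Accumulation points, clubs and strong suprema -/

theorem mem_acc {A : Set Ordinal.{u}} {α : Ordinal.{u}} :
    α ∈ acc A ↔ α ∈ A ∧ 0 < α ∧ ∀ ξ < α, ∃ a ∈ A, ξ < a ∧ a < α := by
  have hb : BddAbove (A ∩ Iio α) := ⟨α, fun a ha => ha.2.le⟩
  refine ⟨fun ⟨h, h', h0⟩ => ⟨h, h0, fun ξ hξ => ?_⟩, fun ⟨h, h0, h'⟩ => ⟨h, ?_, h0⟩⟩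
  · rw [← h'] at hξ
    obtain ⟨a, ha, h⟩ := exists_lt_of_lt_csSup' hξ
    exact ⟨a, ha.1, h, ha.2⟩
  · refine le_antisymm (csSup_le' fun a ha => ha.2.le) (le_of_forall_lt fun ξ hξ => ?_)
    obtain ⟨a, ha, h1, h2⟩ := h' ξ hξ
    exact h1.trans_le (le_csSup hb ⟨ha, h2⟩)

theorem acc_mono {A B : Set Ordinal.{u}} (h : A ⊆ B) : acc A ⊆ acc B := fun α hα => by
  rw [mem_acc] at hα ⊢
  exact ⟨h hα.1, hα.2.1, fun ξ hξ => (hα.2.2 ξ hξ).imp fun a ha => ⟨h ha.1, ha.2⟩⟩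

theorem mem_acc_inter_Iio {A : Set Ordinal.{u}} {α β : Ordinal.{u}} (h : α < β) :
    α ∈ acc (A ∩ Iio β) ↔ α ∈ acc A := by
  refine ⟨fun hα => acc_mono inter_subset_left hα, fun hα => ?_⟩
  rw [mem_acc] at hα ⊢
  refine ⟨⟨hα.1, h⟩, hα.2.1, fun ξ hξ => ?_⟩
  obtain ⟨a, ha, h1, h2⟩ := hα.2.2 ξ hξ
  exact ⟨a, ⟨ha, h2.trans h⟩, h1, h2⟩

theorem mem_acc_Iio {o α : Ordinal.{u}} : α ∈ acc (Iio o) ↔ α < o ∧ Order.IsSuccLimit α := by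
  rw [mem_acc, mem_Iio]
  refine and_congr_right fun ho => ⟨fun ⟨h0, h⟩ => ?_, fun h => ⟨h.bot_lt, fun ξ hξ =>
    ⟨Order.succ ξ, (h.succ_lt hξ).trans ho, Order.lt_succ ξ, h.succ_lt hξ⟩⟩⟩
  refine ⟨by simpa using h0.ne', fun ξ hξ => ?_⟩
  obtain ⟨a, -, h1, h2⟩ := h ξ hξ.lt
  exact hξ.2 h1 h2

theorem isClubIn_iff {C : Set Ordinal.{u}} {α : Ordinal.{u}} :
    IsClubIn C α ↔ C ⊆ Iio α ∧
      (∀ β < α, 0 < β → (∀ ξ < β, ∃ a ∈ C, ξ < a ∧ a < β) → β ∈ C) ∧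
      ∀ ξ < α, ∃ a ∈ C, ξ ≤ a := by
  refine and_congr_right fun hC => ⟨fun h => ⟨fun β hβ h0 hlim => ?_, fun ξ hξ => ?_⟩,
    fun ⟨h1, h2⟩ => ⟨?_, ?_⟩⟩
  · obtain ⟨a, ha, -, haβ⟩ := hlim 0 h0
    refine h.isLUB_mem (t := {x : Iio α | x.1 ∈ C ∧ x.1 < β}) (x := ⟨β, hβ⟩) (fun x hx => hx.1)
      ⟨⟨a, hC ha⟩, ha, haβ⟩ ⟨fun x hx => hx.2.le, fun b hb => ?_⟩
    refine Subtype.mk_le_mk.2 (le_of_forall_lt fun ξ hξ => ?_)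
    obtain ⟨a, ha, h1, h2⟩ := hlim ξ hξ
    exact h1.trans_le (hb (show (⟨a, hC ha⟩ : Iio α) ∈ _ from ⟨ha, h2⟩))
  · obtain ⟨a, ha, h⟩ := h.isCofinal ⟨ξ, hξ⟩
    exact ⟨a, ha, h⟩
  · intro t ht hne _ x hx
    by_cases hxt : x ∈ t
    · exact ht hxt
    have hlt : ∀ y ∈ t, y < x := fun y hy => lt_of_le_of_ne (hx.1 hy) fun h => hxt (h ▸ hy)
    refine h1 x.1 x.2 ?_ fun ξ hξ => ?_
    · obtain ⟨y, hy⟩ := hne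
      exact bot_le.trans_lt (show y.1 < x.1 from hlt y hy)
    · obtain ⟨y, hy, hξy⟩ := (lt_isLUB_iff hx).1 (show (⟨ξ, hξ.trans x.2⟩ : Iio α) < x from hξ)
      exact ⟨y, ht hy, hξy, hlt y hy⟩
  · intro x
    obtain ⟨a, ha, h⟩ := h2 x x.2
    exact ⟨⟨a, hC ha⟩, ha, h⟩

theorem bddAbove_succ_image {x : Set Ordinal.{u}} (hx : BddAbove x) :
    BddAbove (Order.succ '' x) := by
  obtain ⟨b, hb⟩ := hx
  exact ⟨Order.succ b, by rintro _ ⟨a, ha, rfl⟩; exact Order.succ_le_succ (hb ha)⟩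

theorem lt_ssup_iff {x : Set Ordinal.{u}} (hx : BddAbove x) {ξ : Ordinal.{u}} :
    ξ < ssup x ↔ ∃ a ∈ x, ξ ≤ a := by
  rw [ssup, lt_csSup_iff' (bddAbove_succ_image hx)]
  simp

theorem ssup_le_iff {x : Set Ordinal.{u}} (hx : BddAbove x) {ξ : Ordinal.{u}} :
    ssup x ≤ ξ ↔ ∀ a ∈ x, a < ξ := by
  rw [← not_lt, lt_ssup_iff hx]
  simp

theorem lt_ssup {x : Set Ordinal.{u}} (hx : BddAbove x) {a : Ordinal.{u}} (ha : a ∈ x) :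
    a < ssup x := (lt_ssup_iff hx).2 ⟨a, ha, le_rfl⟩

theorem ssup_mono {x y : Set Ordinal.{u}} (hy : BddAbove y) (h : x ⊆ y) : ssup x ≤ ssup y :=
  (ssup_le_iff (hy.mono h)).2 fun _ ha => lt_ssup hy (h ha)

theorem cof_ssup_le_aleph0 {x : Set Ordinal.{u}} (hx : x.Countable) : (ssup x).cof ≤ ℵ₀ := by
  rcases x.eq_empty_or_nonempty with rfl | hne
  · simp [ssup]
  obtain ⟨f, rfl⟩ := hx.exists_eq_range hne
  have := cof_lift_iSup_add_one_le.{u, 0} f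
  rw [ssup, ← range_comp]
  simpa [iSup, Function.comp_def] using this

theorem ssup_lt_ord {κ : Cardinal.{u}} (hκ : κ.IsRegular) {x : Set Ordinal.{u}}
    (hx : x ⊆ Iio κ.ord) (hc : #x < Cardinal.lift.{u + 1} κ) : ssup x < κ.ord := by
  have h := sSup_add_one_lt_of_lt_cof (s := x) (a := κ.ord)
    (by rwa [← Ordinal.lift_cof, hκ.cof_ord]) hx
  rwa [ssup, show (Order.succ : Ordinal.{u} → Ordinal.{u}) = (· + 1) from
    funext Order.succ_eq_add_one]

theorem exists_inter_Iio_omega_one {x : Set Ordinal.{u}} (hx : x.Countable)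
    (h : ∀ a ∈ x, a < ω_ 1 → Iio a ⊆ x) : ∃ δ < ω_ 1, x ∩ Iio (ω_ 1) = Iio δ := by
  have hb : BddAbove (x ∩ Iio (ω_ 1)) := ⟨ω_ 1, fun a ha => ha.2.le⟩
  refine ⟨ssup (x ∩ Iio (ω_ 1)), ?_, ?_⟩
  · rw [← ord_aleph]
    refine ssup_lt_ord isRegular_aleph_one (by simp) ?_
    rw [lift_aleph]
    refine ((le_aleph0_iff_set_countable).2 (hx.mono inter_subset_left)).trans_lt ?_
    simp
  · ext ξ
    rw [mem_Iio, lt_ssup_iff hb]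
    refine ⟨fun hξ => ⟨ξ, hξ, le_rfl⟩, ?_⟩
    rintro ⟨a, ⟨ha, ha'⟩, hξ⟩
    refine ⟨?_, hξ.trans_lt ha'⟩
    rcases hξ.eq_or_lt with rfl | hξ
    exacts [ha, h a ha ha' hξ]

/-! ### The colouring induced by a weak indexed square sequence -/

namespace IsWeakIndexedSquareSeq

variable {κ θ : Cardinal.{u}} {Γ : Set Ordinal.{u}} {idx : Ordinal.{u} → Ordinal.{u}}
  {C : Ordinal.{u} → Ordinal.{u} → Set Ordinal.{u}}

/-- `β` is an accumulation point of the `i`-th club of `α`. -/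
def Rel (idx : Ordinal.{u} → Ordinal.{u}) (C : Ordinal.{u} → Ordinal.{u} → Set Ordinal.{u})
    (i β α : Ordinal.{u}) : Prop :=
  idx α ≤ i ∧ β ∈ acc (C α i)

variable {i j α β γ : Ordinal.{u}}

theorem mem_of_cof_ne (h : IsWeakIndexedSquareSeq κ θ Γ idx C) (hα : α < κ.ord)
    (hlim : Order.IsSuccLimit α) (hc : α.cof ≠ θ) : α ∈ Γ :=
  h.subset_index ⟨⟨hα, hc⟩, mem_acc_Iio.2 ⟨hα, hlim⟩⟩

theorem isSuccLimit (h : IsWeakIndexedSquareSeq κ θ Γ idx C) (hα : α ∈ Γ) :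
    Order.IsSuccLimit α := (mem_acc_Iio.1 (h.index_subset hα)).2

theorem lt_ord (h : IsWeakIndexedSquareSeq κ θ Γ idx C) (hα : α ∈ Γ) : α < κ.ord :=
  (mem_acc_Iio.1 (h.index_subset hα)).1

theorem exists_rel (h : IsWeakIndexedSquareSeq κ θ Γ idx C) (hα : α ∈ Γ) (hβ : β ∈ Γ)
    (hlt : β < α) : ∃ i < θ.ord, Rel idx C i β α := by
  have : β ∈ Γ ∩ Iio α := ⟨hβ, hlt⟩
  rw [h.cover α hα] at this
  obtain ⟨i, hi, hβ⟩ := mem_iUnion₂.1 this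
  exact ⟨i, hi.2, hi.1, hβ⟩

theorem Rel.mono (h : IsWeakIndexedSquareSeq κ θ Γ idx C) (hα : α ∈ Γ)
    (hr : Rel idx C i β α) (hij : i ≤ j) (hj : j < θ.ord) : Rel idx C j β α :=
  ⟨hr.1.trans hij, acc_mono (h.increasing α hα i ⟨hr.1, hij.trans_lt hj⟩ j
    ⟨hr.1.trans hij, hj⟩ hij) hr.2⟩

/-- Subadditivity c(β,α) ≤ max(c(β,γ), c(α,γ)): coherence identifies the i-th club of α with an
initial segment of that of γ. -/
theorem Rel.of_rel (h : IsWeakIndexedSquareSeq κ θ Γ idx C) (hγ : γ ∈ Γ) (hi : i < θ.ord)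
    (hα : Rel idx C i α γ) (hβ : Rel idx C i β γ) (hlt : β < α) : Rel idx C i β α := by
  obtain ⟨h1, h2⟩ := h.coherent γ hγ i ⟨hα.1, hi⟩ α hα.2
  refine ⟨h1, ?_⟩
  rw [h2, mem_acc_inter_Iio hlt]
  exact hβ.2

/-- Continuity of the colouring: a limit of accumulation points of a club is again one. -/
theorem Rel.of_forall (h : IsWeakIndexedSquareSeq κ θ Γ idx C) (hα : α ∈ Γ) (hi : i < θ.ord)
    (hidx : idx α ≤ i) (hβ : β < α) (h0 : 0 < β)
    (hlim : ∀ ξ < β, ∃ τ, ξ < τ ∧ τ < β ∧ Rel idx C i τ α) : Rel idx C i β α := by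
  have hlim' : ∀ ξ < β, ∃ a ∈ C α i, ξ < a ∧ a < β := fun ξ hξ => by
    obtain ⟨τ, h1, h2, h3⟩ := hlim ξ hξ
    exact ⟨τ, h3.2.1, h1, h2⟩
  exact ⟨hidx, mem_acc.2 ⟨(isClubIn_iff.1 (h.club α hα i ⟨hidx, hi⟩)).2.1 β hβ h0 hlim', h0,
    hlim'⟩⟩

/-- The colouring is not bounded on the pairs from any unbounded set. -/
theorem not_forall_rel (h : IsWeakIndexedSquareSeq κ θ Γ idx C) (hi : i < θ.ord)
    {A : Set Ordinal.{u}} (hA : A ⊆ Γ) (hunb : ∀ ξ < κ.ord, ∃ α ∈ A, ξ < α)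
    (hrel : ∀ α ∈ A, ∀ β ∈ A, α < β → Rel idx C i α β) : False := by
  have hidx : ∀ α ∈ A, idx α ≤ i := fun α hα => by
    obtain ⟨β, hβ, hlt⟩ := hunb α (h.lt_ord (hA hα))
    exact (h.coherent β (hA hβ) i ⟨(hrel α hα β hβ hlt).1, hi⟩ α (hrel α hα β hβ hlt).2).1
  have hclub : ∀ α ∈ A, IsClubIn (C α i) α := fun α hα => h.club α (hA hα) i ⟨hidx α hα, hi⟩
  have hcoh : ∀ α ∈ A, ∀ β ∈ A, α < β → C α i = C β i ∩ Iio α := fun α hα β hβ hlt =>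
    (h.coherent β (hA hβ) i ⟨hidx β hβ, hi⟩ α (hrel α hα β hβ hlt).2).2
  -- The i-th clubs of the members of A end-extend each other, so their union is a club all of whose
  -- proper initial segments at its accumulation points are threaded by the matrix, contrary to
  -- clause 4.
  set D : Set Ordinal.{u} := ⋃ α ∈ A, C α i with hD
  have hDβ : ∀ β ∈ A, D ∩ Iio β = C β i := fun β hβ => by
    refine Subset.antisymm ?_ fun ξ hξ => ⟨mem_biUnion hβ hξ, (hclub β hβ).1 hξ⟩
    rintro ξ ⟨hξ, hξβ⟩
    obtain ⟨α, hα, hξα⟩ := mem_iUnion₂.1 hξ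
    rcases lt_trichotomy α β with hlt | rfl | hlt
    · rw [hcoh α hα β hβ hlt] at hξα
      exact hξα.1
    · exact hξα
    · rw [hcoh β hβ α hα hlt]
      exact ⟨hξα, hξβ⟩
  have hDclub : IsClubIn D κ.ord := by
    refine isClubIn_iff.2 ⟨iUnion₂_subset fun α hα ξ hξ =>
      ((hclub α hα).1 hξ).trans (h.lt_ord (hA hα)), fun δ hδ h0 hlim => ?_, fun ξ hξ => ?_⟩
    · obtain ⟨β, hβ, hlt⟩ := hunb δ hδ
      refine mem_biUnion hβ ((isClubIn_iff.1 (hclub β hβ)).2.1 δ hlt h0 fun ξ hξ => ?_)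
      obtain ⟨a, ha, h1, h2⟩ := hlim ξ hξ
      refine ⟨a, ?_, h1, h2⟩
      rw [← hDβ β hβ]
      exact ⟨ha, h2.trans hlt⟩
    · obtain ⟨β, hβ, hlt⟩ := hunb ξ hξ
      obtain ⟨a, ha, h1⟩ := (isClubIn_iff.1 (hclub β hβ)).2.2 ξ hlt
      exact ⟨a, mem_biUnion hβ ha, h1⟩
  obtain ⟨α, ⟨hα, hαΓ⟩, hne⟩ := h.nontrivial D hDclub
  obtain ⟨β, hβ, hlt⟩ := hunb α (h.lt_ord hαΓ)
  have hα' : α ∈ acc (C β i) := by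
    rw [← hDβ β hβ, mem_acc_inter_Iio hlt]
    exact hα
  obtain ⟨h1, h2⟩ := h.coherent β (hA hβ) i ⟨hidx β hβ, hi⟩ α hα'
  refine hne i ⟨h1, hi⟩ ?_
  rw [h2, ← hDβ β hβ, inter_assoc, inter_eq_self_of_subset_right (Iio_subset_Iio hlt.le)]

end IsWeakIndexedSquareSeq

/-! ### The family of sets with large colour does not reflect. -/

namespace IsWeakIndexedSquareSeq

variable {κ : Cardinal.{u}} {Γ : Set Ordinal.{u}} {idx : Ordinal.{u} → Ordinal.{u}}
  {C : Ordinal.{u} → Ordinal.{u} → Set Ordinal.{u}}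

/-- The countable subsets of `κ` on which the colouring exceeds the trace on `ω₁`. -/
def largeColour (κ : Cardinal.{u}) (Γ : Set Ordinal.{u}) (idx : Ordinal.{u} → Ordinal.{u})
    (C : Ordinal.{u} → Ordinal.{u} → Set Ordinal.{u}) : Set (Set Ordinal.{u}) :=
  {x ∈ countableSubsets (Iio κ.ord) | ∃ δ < ω_ 1, x ∩ Iio (ω_ 1) = Iio δ ∧ ssup x ∈ Γ ∧
    ∃ γ ∈ x, γ.cof = ℵ_ 1 ∧ ssup (x ∩ Iio γ) ∈ Γ ∧ ¬ Rel idx C δ (ssup (x ∩ Iio γ)) (ssup x)}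

/-- Membership depends only on the trace and the suprema that ⊑* preserves, and the witness γ ∈ x
remains in y. -/
theorem largeColour_upward {x y : Set Ordinal.{u}} (hx : x ∈ largeColour κ Γ idx C)
    (hy : y ∈ countableSubsets (Iio κ.ord)) (hxy : StarExtends x y) :
    y ∈ largeColour κ Γ idx C := by
  obtain ⟨-, δ, hδ, htr, hs, γ, hγ, hcof, hsγ, hn⟩ := hx
  refine ⟨hy, δ, hδ, hxy.inter_omega_one ▸ htr, hxy.ssup_eq ▸ hs, γ, hxy.subset hγ, hcof, ?_⟩
  rw [← hxy.ssup_eq, ← hxy.ssup_inter_eq γ hγ hcof]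
  exact ⟨hsγ, hn⟩

/-- If `x` is closed under a suitable operation, then the colour of `ssup (x ∩ V)` and `ε` is
at most the trace of `x` on `ω₁`. -/
theorem exists_op_rel_ssup (h : IsWeakIndexedSquareSeq κ (ℵ_ 1) Γ idx C) {W V : Set Ordinal.{u}}
    (hωW : Iio (ω_ 1) ⊆ W) (hVW : V ⊆ W) {ε : Ordinal.{u}} (hε : ε ∈ Γ)
    (hWb : BddAbove W) (hWε : ssup W < ε) :
    ∃ G : Finset Ordinal.{u} → Set Ordinal.{u}, (∀ e, (G e).Countable) ∧
      ∀ x ⊆ W, ClosedUnder (fun e => G e ∩ W) x → ∀ δ < ω_ 1, x ∩ Iio (ω_ 1) = Iio δ →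
        ssup (x ∩ V) ∈ Γ → Rel idx C δ (ssup (x ∩ V)) ε := by
  have hVε : ssup V < ε := (ssup_mono hWb hVW).trans_lt hWε
  have hVb : BddAbove V := hWb.mono hVW
  -- Some point τ of Γ above ζ is caught below an element w of V, and i bounds its colour with ε.
  -- Closing x under w and i puts such τ cofinally below ssup (x ∩ V), with colours below δ.
  have hstep : ∀ ζ : Ordinal.{u}, ∃ w i τ : Ordinal.{u},
      (∃ v ∈ V, ∃ τ ∈ Γ, ζ < τ ∧ τ ≤ v) →
        w ∈ V ∧ ζ < τ ∧ τ ≤ w ∧ i < ω_ 1 ∧ Rel idx C i τ ε := fun ζ => by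
    by_cases hζ : ∃ v ∈ V, ∃ τ ∈ Γ, ζ < τ ∧ τ ≤ v
    · obtain ⟨w, hw, τ, hτ, h1, h2⟩ := hζ
      obtain ⟨i, hi, hr⟩ := h.exists_rel hε hτ (h2.trans_lt ((lt_ssup hVb hw).trans hVε))
      rw [ord_aleph] at hi
      exact ⟨w, i, τ, fun _ => ⟨hw, h1, h2, hi, hr⟩⟩
    · exact ⟨0, 0, 0, fun hζ' => (hζ hζ').elim⟩
  choose w i τ hstep using hstep
  obtain ⟨i₀, hi₀⟩ : ∃ i₀, ssup V ∈ Γ → i₀ < ω_ 1 ∧ Rel idx C i₀ (ssup V) ε := by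
    by_cases hV : ssup V ∈ Γ
    · obtain ⟨i, hi, hr⟩ := h.exists_rel hε hV hVε
      rw [ord_aleph] at hi
      exact ⟨i, fun _ => ⟨hi, hr⟩⟩
    · exact ⟨0, fun hV' => (hV hV').elim⟩
  refine ⟨fun e => {idx ε, i₀} ∪ ⋃ ζ ∈ e, {w ζ, i ζ}, fun e => ?_, fun x hxW hx δ hδ htr hxΓ => ?_⟩
  · exact (by simp : Set.Countable _).union
      (e.countable_toSet.biUnion fun _ _ => (by simp : Set.Countable _))
  have hδ' : δ < (ℵ_ 1).ord := by rwa [ord_aleph]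
  have hmemδ : ∀ j < ω_ 1, j ∈ x → j < δ := fun j hj hjx => by
    have : j ∈ x ∩ Iio (ω_ 1) := ⟨hjx, hj⟩
    rwa [htr] at this
  have hconst : ∀ j ∈ ({idx ε, i₀} : Set Ordinal.{u}), j < ω_ 1 → j < δ := fun j hj hlt =>
    hmemδ j hlt (hx ∅ (by simp) ⟨Or.inl hj, hωW hlt⟩)
  have hidx : idx ε < δ := hconst _ (by simp) (by simpa only [ord_aleph] using h.idx_lt ε hε)
  have hxVb : BddAbove (x ∩ V) := hVb.mono inter_subset_right
  -- Below ssup V, the point ssup (x ∩ V) itself shows that a suitable τ exists above each element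
  -- of x ∩ V, and continuity applies. At ssup V the colour is bounded by the constant i₀, which
  -- lies in x.
  rcases lt_or_ge (ssup (x ∩ V)) (ssup V) with hlt | hge
  · obtain ⟨v, hv, hle⟩ := (lt_ssup_iff hVb).1 hlt
    have hlim := h.isSuccLimit hxΓ
    refine Rel.of_forall h hε hδ' hidx.le (hlt.trans hVε) hlim.bot_lt fun ξ hξ => ?_
    obtain ⟨a, ha, hξa⟩ := (lt_ssup_iff hxVb).1 hξ
    obtain ⟨h1, h2, h3, h4, h5⟩ := hstep a ⟨v, hv, _, hxΓ, lt_ssup hxVb ha, hle⟩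
    have hax : (({a} : Finset Ordinal.{u}) : Set Ordinal.{u}) ⊆ x := by simpa using ha.1
    have hwx : w a ∈ x := hx {a} hax ⟨Or.inr (by simp), hVW h1⟩
    have hix : i a ∈ x := hx {a} hax ⟨Or.inr (by simp), hωW h4⟩
    exact ⟨τ a, hξa.trans_lt h2, h3.trans_lt (lt_ssup hxVb ⟨hwx, h1⟩),
      h5.mono h hε (hmemδ _ h4 hix).le hδ'⟩
  · have heq : ssup (x ∩ V) = ssup V := (ssup_mono hVb inter_subset_right).antisymm hge
    rw [heq] at hxΓ ⊢
    exact (hi₀ hxΓ).2.mono h hε (hconst _ (by simp) (hi₀ hxΓ).1).le hδ'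

theorem not_reflects_largeColour (h : IsWeakIndexedSquareSeq κ (ℵ_ 1) Γ idx C)
    (hκ : κ.IsRegular) (hκ2 : ℵ_ 2 ≤ κ) {W : Set Ordinal.{u}} (hWκ : W ⊆ Iio κ.ord)
    (hW : #W = ℵ_ 1) (hωW : Iio (ω_ 1) ⊆ W) :
    ¬ IsStationaryFamily W (largeColour κ Γ idx C ∩ countableSubsets W) := by
  classical
  intro hS
  have hWb : BddAbove W := ⟨κ.ord, fun a ha => (hWκ ha).le⟩
  have hWlt : ssup W < κ.ord := by
    refine ssup_lt_ord hκ hWκ ?_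
    rw [hW, show (ℵ_ 1 : Cardinal.{u + 1}) = Cardinal.lift.{u + 1} (ℵ_ 1 : Cardinal.{u}) by simp,
      Cardinal.lift_lt]
    refine lt_of_lt_of_le ?_ hκ2
    simp
  have hωκ : ω < κ.ord := by
    rw [← ord_aleph0, ord_lt_ord]
    refine lt_of_lt_of_le ?_ hκ2
    simp
  -- Adding ω gives cofinality ω ≠ ω₁, which guarantees a point of Γ strictly above ssup W.
  have hεΓ : ssup W + ω ∈ Γ := by
    refine h.mem_of_cof_ne (isPrincipal_add_ord hκ.1 hWlt hωκ)
      (isSuccLimit_add _ isSuccLimit_omega0) ?_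
    rw [cof_add _ omega0_ne_zero, cof_omega0]
    simp [← aleph_zero]
  have hWε : ssup W < ssup W + ω := by simp
  obtain ⟨G, hGc, hG⟩ := h.exists_op_rel_ssup hωW subset_rfl hεΓ hWb hWε
  choose Gγ hGγc hGγ using fun γ : Ordinal.{u} =>
    h.exists_op_rel_ssup hωW (V := W ∩ Iio γ) inter_subset_left hεΓ hWb hWε
  -- A diagonal intersection: x is closed under the operation for W ∩ γ for every γ ∈ x. The subsets
  -- e' of e allow γ to be adjoined to the argument.
  obtain ⟨x, ⟨hxS, hxW⟩, hx⟩ := hS.exists_closedUnder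
    (G := fun e => G e ∪ ⋃ γ ∈ e, ⋃ e' ∈ e.powerset, Gγ γ e')
    fun e => (hGc e).union (e.countable_toSet.biUnion fun γ _ =>
      e.powerset.countable_toSet.biUnion fun e' _ => hGγc γ e')
  obtain ⟨-, δ, hδ, htr, hs, γ, hγ, hcof, hsγ, hn⟩ := hxS
  have hxb : BddAbove x := hWb.mono hxW.1
  have h1 : Rel idx C δ (ssup x) (ssup W + ω) := by
    have := hG x hxW.1 (hx.mono fun e => inter_subset_inter_left _ subset_union_left) δ hδ htr
    rw [inter_eq_self_of_subset_left hxW.1] at this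
    exact this hs
  have h2 : Rel idx C δ (ssup (x ∩ Iio γ)) (ssup W + ω) := by
    have := hGγ γ x hxW.1 (fun e he => ?_) δ hδ htr
    · rw [← inter_assoc, inter_eq_self_of_subset_left hxW.1] at this
      exact this hsγ
    · refine Subset.trans ?_ (hx (insert γ e) ?_)
      · refine inter_subset_inter_left _ (Subset.trans ?_ subset_union_right)
        intro a ha
        simp only [mem_iUnion]
        exact ⟨γ, by simp, e, by simp, ha⟩
      · rw [Finset.coe_insert]
        exact insert_subset hγ he
  refine hn (h1.of_rel h hεΓ (by rwa [ord_aleph]) h2 ?_)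
  exact ((ssup_le_iff (hxb.mono inter_subset_left)).2 fun a ha => ha.2).trans_lt (lt_ssup hxb hγ)

end IsWeakIndexedSquareSeq

theorem countable_Iio_of_lt_omega_one {δ : Ordinal.{u}} (hδ : δ < ω_ 1) : (Iio δ).Countable := by
  rw [← le_aleph0_iff_set_countable, Cardinal.mk_Iio_ordinal, Cardinal.lift_le_aleph0]
  rw [← ord_aleph, lt_ord, ← succ_aleph0, Order.lt_succ_iff] at hδ
  exact hδ

/-! ### A game on ordinals

Two players choose ordinals below `κ`; the second has to exceed the first's moves and tries to
keep the trace on `ω₁` of the closure of the chosen ordinals below `δ`. -/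

section Game

variable {κ : Cardinal.{u}} {G : Finset Ordinal.{u} → Set Ordinal.{u}} {δ : Ordinal.{u}}
  {s t : Set Ordinal.{u}}

/-- The closure of `δ ∪ s` has trace `δ` on `ω₁`. -/
def TraceBounded (G : Finset Ordinal.{u} → Set Ordinal.{u}) (δ : Ordinal.{u})
    (s : Set Ordinal.{u}) : Prop :=
  opClosure G (Iio δ ∪ s) ∩ Iio (ω_ 1) ⊆ Iio δ

/-- `σ` is a winning strategy for the first player in the position `s`. -/
def IsWinning (κ : Cardinal.{u}) (G : Finset Ordinal.{u} → Set Ordinal.{u}) (δ : Ordinal.{u})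
    (s : Set Ordinal.{u}) (σ : List Ordinal.{u} → Ordinal.{u}) : Prop :=
  (∀ l, σ l < κ.ord) ∧ ∀ η : ℕ → Ordinal.{u},
    (∀ n, η n < κ.ord ∧ σ ((List.range n).map η) < η n) → ¬ TraceBounded G δ (s ∪ range η)

theorem TraceBounded.mono (h : TraceBounded G δ t) (hst : s ⊆ t) : TraceBounded G δ s :=
  (inter_subset_inter_left _ (opClosure_mono (union_subset_union_right _ hst))).trans h

theorem exists_mem_opClosure_of_mem_iUnion {s : ℕ → Set Ordinal.{u}} (hs : Monotone s)
    {a : Ordinal.{u}} (ha : a ∈ opClosure G (Iio δ ∪ ⋃ n, s n)) :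
    ∃ n, a ∈ opClosure G (Iio δ ∪ s n) := by
  obtain ⟨e, he, ha⟩ := mem_opClosure_iff_finite.1 ha
  have hmono : Monotone fun n => Iio δ ∪ s n := fun m n hmn => union_subset_union_right _ (hs hmn)
  rw [union_iUnion] at he
  obtain ⟨n, hn⟩ := hmono.directed_le.exists_mem_subset_of_finset_subset_biUnion he
  exact ⟨n, opClosure_mono hn ha⟩

theorem TraceBounded.iUnion {s : ℕ → Set Ordinal.{u}} (hs : Monotone s)
    (h : ∀ n, TraceBounded G δ (s n)) : TraceBounded G δ (⋃ n, s n) := by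
  rintro a ⟨ha, haω⟩
  obtain ⟨n, hn⟩ := exists_mem_opClosure_of_mem_iUnion hs ha
  exact h n ⟨hn, haω⟩

theorem traceBounded_of_not_isWinning (h : ¬ ∃ σ, IsWinning κ G δ s σ) (hκ : 0 < κ.ord) :
    TraceBounded G δ s := by
  by_contra hs
  exact h ⟨fun _ => 0, fun _ => hκ, fun η _ hη => hs (hη.mono subset_union_left)⟩

/-- Otherwise the first player wins from s by opening with ζ and then following a winning strategy
for the position reached by the reply. -/
theorem exists_not_isWinning_insert (h : ¬ ∃ σ, IsWinning κ G δ s σ) {ζ : Ordinal.{u}}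
    (hζ : ζ < κ.ord) :
    ∃ η, ζ < η ∧ η < κ.ord ∧ ¬ ∃ σ, IsWinning κ G δ (insert η s) σ := by
  by_contra! hn
  have hn' : ∀ η, ∃ σ, (∀ l, σ l < κ.ord) ∧
      (ζ < η → η < κ.ord → IsWinning κ G δ (insert η s) σ) := fun η => by
    by_cases hη : ζ < η ∧ η < κ.ord
    · obtain ⟨σ, hσ⟩ := hn η hη.1 hη.2
      exact ⟨σ, hσ.1, fun _ _ => hσ⟩
    · exact ⟨fun _ => ζ, fun _ => hζ, fun h1 h2 => (hη ⟨h1, h2⟩).elim⟩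
  choose σ hσ hσ' using hn'
  refine h ⟨fun l => l.casesOn ζ fun a l => σ a l, fun l => ?_, fun η hη hb => ?_⟩
  · cases l
    exacts [hζ, hσ _ _]
  · have h0 : ζ < η 0 := (hη 0).2
    refine (hσ' (η 0) h0 (hη 0).1).2 (fun n => η (n + 1)) (fun n => ⟨(hη _).1, ?_⟩) (hb.mono ?_)
    · have := (hη (n + 1)).2
      rwa [List.range_succ_eq_map, List.map_cons, List.map_map] at this
    · rw [insert_union]
      refine insert_subset (Or.inr ⟨0, rfl⟩) (union_subset_union_right _ ?_)
      rintro _ ⟨n, rfl⟩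
      exact ⟨n + 1, rfl⟩

theorem mk_Iio_omega_one : #(Iio (ω_ 1 : Ordinal.{u})) = ℵ_ 1 := by
  rw [Cardinal.mk_Iio_ordinal, card_omega]
  simp

/-- If the first player won for every δ, a single play could beat all ω₁ strategies at once: each
move exceeds the supremum of their moves, which is below κ by regularity. The closure of that play
has some trace δ, so the strategy for this δ loses. -/
theorem exists_not_isWinning (hκ : κ.IsRegular) (hκ2 : ℵ_ 2 ≤ κ) (hG : ∀ e, (G e).Countable)
    (hGω : ∀ e, ∀ a ∈ e, a < ω_ 1 → Iio a ⊆ G e) :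
    ∃ δ < ω_ 1, ¬ ∃ σ, IsWinning κ G δ ∅ σ := by
  by_contra! hn
  choose! σ hσ using hn
  have hb : ∀ l, ssup ((fun δ => σ δ l) '' Iio (ω_ 1)) < κ.ord := fun l => by
    refine ssup_lt_ord hκ ?_ (mk_image_le.trans_lt ?_)
    · rintro _ ⟨δ, hδ, rfl⟩
      exact (hσ δ hδ).1 l
    · rw [mk_Iio_omega_one, show (ℵ_ 1 : Cardinal.{u + 1}) =
        Cardinal.lift.{u + 1} (ℵ_ 1 : Cardinal.{u}) by simp, Cardinal.lift_lt]
      refine lt_of_lt_of_le ?_ hκ2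
      simp
  set b : List Ordinal.{u} → Ordinal.{u} := fun l => ssup ((fun δ => σ δ l) '' Iio (ω_ 1))
  let L : ℕ → List Ordinal.{u} := Nat.rec [] fun _ l => l ++ [b l]
  let η : ℕ → Ordinal.{u} := fun n => b (L n)
  have hL : ∀ n, L n = (List.range n).map η := fun n => by
    induction n with
    | zero => rfl
    | succ n ih =>
      rw [List.range_succ, List.map_append, ← ih]
      rfl
  have hcl : ClosedUnder G (opClosure G (range η)) := closedUnder_opClosure
  obtain ⟨δ, hδ, htr⟩ := exists_inter_Iio_omega_one ((countable_range η).opClosure hG)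
    fun a ha haω => (hGω {a} a (by simp) haω).trans (hcl {a} (by simpa using ha))
  refine (hσ δ hδ).2 η (fun n => ⟨hb _, ?_⟩) ?_
  · rw [← hL]
    refine lt_ssup ⟨κ.ord, ?_⟩ (mem_image_of_mem (fun δ => σ δ (L n)) hδ)
    rintro _ ⟨δ, hδ, rfl⟩
    exact ((hσ δ hδ).1 _).le
  · rw [TraceBounded, ← htr, empty_union]
    refine inter_subset_inter_left _ (opClosure_subset (union_subset ?_ subset_opClosure) hcl)
    exact inter_subset_left

/-- One step of the interleaving in `exists_closedUnder_pair`: s gets a new point above the closure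
of t without becoming a won position. -/
theorem exists_position_extension (hκ : κ.IsRegular) (hκ2 : ℵ_ 2 ≤ κ)
    (hG : ∀ e, (G e).Countable) (hGκ : ∀ e, G e ⊆ Iio κ.ord) (hδ : δ < ω_ 1)
    (hs : ¬ ∃ σ, IsWinning κ G δ s σ) (hsκ : s ⊆ Iio κ.ord) (hsc : s.Countable)
    (htκ : t ⊆ Iio κ.ord) (htc : t.Countable) :
    ∃ s', s ⊆ s' ∧ (¬ ∃ σ, IsWinning κ G δ s' σ) ∧ s' ⊆ Iio κ.ord ∧ s'.Countable ∧
      ∃ ρ ∈ s', ∀ a ∈ opClosure G (Iio δ ∪ t), a < ρ := by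
  have hωκ : ω_ 1 < κ.ord := by
    rw [← ord_aleph, ord_lt_ord]
    refine lt_of_lt_of_le ?_ hκ2
    simp
  have hδc := countable_Iio_of_lt_omega_one hδ
  have hsub : opClosure G (Iio δ ∪ t) ⊆ Iio κ.ord :=
    opClosure_subset (union_subset (Iio_subset_Iio (hδ.trans hωκ).le) htκ) fun e _ => hGκ e
  have hlt : ssup (opClosure G (Iio δ ∪ t)) < κ.ord := by
    refine ssup_lt_ord hκ hsub (lt_of_le_of_lt
      (le_aleph0_iff_set_countable.2 ((hδc.union htc).opClosure hG)) ?_)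
    rw [aleph0_lt_lift]
    refine lt_of_lt_of_le ?_ hκ2
    simp
  obtain ⟨ρ, h1, h2, h3⟩ := exists_not_isWinning_insert hs hlt
  refine ⟨insert ρ s, subset_insert _ _, h3, insert_subset h2 hsκ, hsc.insert _, ρ,
    mem_insert _ _, fun a ha => (lt_ssup ⟨κ.ord, fun a ha => (hsub ha).le⟩ ha).trans h1⟩

/-- Two countable closed sets with the same trace and the same supremum. -/
theorem exists_closedUnder_pair (hκ : κ.IsRegular) (hκ2 : ℵ_ 2 ≤ κ)
    (hG : ∀ e, (G e).Countable) (hGκ : ∀ e, G e ⊆ Iio κ.ord) (hδ : δ < ω_ 1)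
    (hs : ¬ ∃ σ, IsWinning κ G δ s σ) (hsκ : s ⊆ Iio κ.ord) (hsc : s.Countable)
    (ht : ¬ ∃ σ, IsWinning κ G δ t σ) (htκ : t ⊆ Iio κ.ord) (htc : t.Countable) :
    ∃ x y : Set Ordinal.{u}, s ⊆ x ∧ t ⊆ y ∧ x ⊆ Iio κ.ord ∧ y ⊆ Iio κ.ord ∧ x.Countable ∧
      y.Countable ∧ ClosedUnder G x ∧ ClosedUnder G y ∧ x ∩ Iio (ω_ 1) = Iio δ ∧
      y ∩ Iio (ω_ 1) = Iio δ ∧ ssup x = ssup y := by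
  let Good : Set Ordinal.{u} → Prop := fun s =>
    (¬ ∃ σ, IsWinning κ G δ s σ) ∧ s ⊆ Iio κ.ord ∧ s.Countable
  have hext : ∀ s t, ∃ s', Good s → Good t → s ⊆ s' ∧ Good s' ∧
      ∃ ρ ∈ s', ∀ a ∈ opClosure G (Iio δ ∪ t), a < ρ := fun s t => by
    by_cases h : Good s ∧ Good t
    · obtain ⟨s', h1, h2, h3, h4, h5⟩ := exists_position_extension hκ hκ2 hG hGκ hδ h.1.1 h.1.2.1
        h.1.2.2 h.2.2.1 h.2.2.2
      exact ⟨s', fun _ _ => ⟨h1, ⟨h2, h3, h4⟩, h5⟩⟩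
    · exact ⟨s, fun h1 h2 => (h ⟨h1, h2⟩).elim⟩
  choose f hf using hext
  -- The two positions overtake each other's closures alternately; the second one answers the
  -- already extended first one. So the closures of the two unions have the same supremum.
  let P : ℕ → Set Ordinal.{u} × Set Ordinal.{u} :=
    Nat.rec (s, t) fun _ p => (f p.1 p.2, f p.2 (f p.1 p.2))
  have hP : ∀ n, Good (P n).1 ∧ Good (P n).2 := fun n => by
    induction n with
    | zero => exact ⟨⟨hs, hsκ, hsc⟩, ht, htκ, htc⟩
    | succ n ih =>
      have h1 := (hf _ _ ih.1 ih.2).2.1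
      exact ⟨h1, (hf _ _ ih.2 h1).2.1⟩
  have hm1 : Monotone fun n => (P n).1 :=
    monotone_nat_of_le_succ fun n => (hf _ _ (hP n).1 (hP n).2).1
  have hm2 : Monotone fun n => (P n).2 :=
    monotone_nat_of_le_succ fun n => (hf _ _ (hP n).2 (hP (n + 1)).1).1
  have hωκ : ω_ 1 < κ.ord := by
    rw [← ord_aleph, ord_lt_ord]
    refine lt_of_lt_of_le ?_ hκ2
    simp
  have hδc := countable_Iio_of_lt_omega_one hδ
  have main : ∀ Q : ℕ → Set Ordinal.{u}, Monotone Q → (∀ n, Good (Q n)) →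
      opClosure G (Iio δ ∪ ⋃ n, Q n) ⊆ Iio κ.ord ∧ (opClosure G (Iio δ ∪ ⋃ n, Q n)).Countable ∧
      opClosure G (Iio δ ∪ ⋃ n, Q n) ∩ Iio (ω_ 1) = Iio δ := fun Q hQ hgood => by
    refine ⟨opClosure_subset (union_subset (Iio_subset_Iio (hδ.trans hωκ).le)
      (iUnion_subset fun n => (hgood n).2.1)) fun e _ => hGκ e,
      (hδc.union (countable_iUnion fun n => (hgood n).2.2)).opClosure hG, Subset.antisymm ?_ ?_⟩
    · exact TraceBounded.iUnion hQ fun n =>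
        traceBounded_of_not_isWinning (hgood n).1 (bot_le.trans_lt hωκ)
    · exact fun a ha => ⟨subset_opClosure (Or.inl ha), ha.trans hδ⟩
  obtain ⟨h1, h2, h3⟩ := main _ hm1 fun n => (hP n).1
  obtain ⟨h4, h5, h6⟩ := main _ hm2 fun n => (hP n).2
  have hb1 : BddAbove (opClosure G (Iio δ ∪ ⋃ n, (P n).1)) := ⟨κ.ord, fun a ha => (h1 ha).le⟩
  have hb2 : BddAbove (opClosure G (Iio δ ∪ ⋃ n, (P n).2)) := ⟨κ.ord, fun a ha => (h4 ha).le⟩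
  refine ⟨_, _, (subset_iUnion (fun n => (P n).1) 0).trans (subset_union_right.trans
    subset_opClosure), (subset_iUnion (fun n => (P n).2) 0).trans (subset_union_right.trans
    subset_opClosure), h1, h4, h2, h5, closedUnder_opClosure, closedUnder_opClosure, h3, h6,
    le_antisymm ?_ ?_⟩
  · refine (ssup_le_iff hb1).2 fun a ha => ?_
    obtain ⟨n, hn⟩ := exists_mem_opClosure_of_mem_iUnion hm1 ha
    obtain ⟨ρ, hρ, hlt⟩ := (hf _ _ (hP n).2 (hP (n + 1)).1).2.2
    exact (hlt a (opClosure_mono (union_subset_union_right _ (hm1 n.le_succ)) hn)).trans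
      (lt_ssup hb2 (subset_opClosure (Or.inr (mem_iUnion.2 ⟨n + 1, hρ⟩))))
  · refine (ssup_le_iff hb2).2 fun a ha => ?_
    obtain ⟨n, hn⟩ := exists_mem_opClosure_of_mem_iUnion hm2 ha
    obtain ⟨ρ, hρ, hlt⟩ := (hf _ _ (hP n).1 (hP n).2).2.2
    exact (hlt a hn).trans (lt_ssup hb1 (subset_opClosure (Or.inr (mem_iUnion.2 ⟨n + 1, hρ⟩))))

end Game

/-! ### The family of sets with large colour is stationary. -/

namespace IsWeakIndexedSquareSeq

variable {κ : Cardinal.{u}} {Γ : Set Ordinal.{u}} {idx : Ordinal.{u} → Ordinal.{u}}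
  {C : Ordinal.{u} → Ordinal.{u} → Set Ordinal.{u}}

/-- The operation closing a set under ordinal arithmetic and making its trace on `ω₁` an
initial segment. -/
def arithOp (e : Finset Ordinal.{u}) : Set Ordinal.{u} :=
  {0} ∪ (⋃ a ∈ e, {b | a < ω_ 1 ∧ b < a}) ∪ (⋃ a ∈ e, {a + 1, a + ω_ 1}) ∪
    ⋃ a ∈ e, ⋃ b ∈ e, {a + b, a - b}

theorem countable_arithOp (e : Finset Ordinal.{u}) : (arithOp e).Countable := by
  refine (((countable_singleton _).union (e.countable_toSet.biUnion fun a _ => ?_)).union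
    (e.countable_toSet.biUnion fun a _ => by simp)).union
    (e.countable_toSet.biUnion fun a _ => e.countable_toSet.biUnion fun b _ => by simp)
  by_cases ha : a < ω_ 1
  · exact (countable_Iio_of_lt_omega_one ha).mono fun b hb => hb.2
  · exact countable_empty.mono fun b hb => (ha hb.1).elim

section

variable {x : Set Ordinal.{u}} {δ ρ : Ordinal.{u}}

theorem arithOp_mem (hx : ClosedUnder (fun e => arithOp e ∩ Iio κ.ord) x) (hκ : κ.IsRegular)
    (hωκ : ω_ 1 < κ.ord) (hxκ : x ⊆ Iio κ.ord) :
    0 ∈ x ∧ (∀ a ∈ x, a + 1 ∈ x ∧ a + ω_ 1 ∈ x) ∧ ∀ a ∈ x, ∀ b ∈ x, a + b ∈ x ∧ a - b ∈ x := by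
  classical
  have h1κ : (1 : Ordinal.{u}) < κ.ord :=
    (one_lt_omega0.trans_le (omega0_le_omega 1)).trans hωκ
  have hadd := isPrincipal_add_ord hκ.1
  refine ⟨hx ∅ (by simp) ⟨by simp [arithOp], bot_le.trans_lt hωκ⟩, fun a ha => ⟨?_, ?_⟩,
    fun a ha b hb => ⟨?_, ?_⟩⟩
  · exact hx {a} (by simpa using ha) ⟨by simp [arithOp], hadd (hxκ ha) h1κ⟩
  · exact hx {a} (by simpa using ha) ⟨by simp [arithOp], hadd (hxκ ha) hωκ⟩
  · refine hx {a, b} (by simp [insert_subset_iff, ha, hb]) ⟨Or.inr ?_, hadd (hxκ ha) (hxκ hb)⟩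
    exact mem_biUnion (show a ∈ _ by simp) (mem_biUnion (show b ∈ _ by simp) (by simp))
  · refine hx {a, b} (by simp [insert_subset_iff, ha, hb])
      ⟨Or.inr ?_, (Ordinal.sub_le_self a b).trans_lt (hxκ ha)⟩
    exact mem_biUnion (show a ∈ _ by simp) (mem_biUnion (show b ∈ _ by simp) (by simp))

theorem isSuccLimit_ssup (hb : BddAbove x) (h0 : 0 ∈ x) (h1 : ∀ a ∈ x, a + 1 ∈ x) :
    Order.IsSuccLimit (ssup x) := by
  rw [Ordinal.isSuccLimit_iff, Order.isSuccPrelimit_iff_succ_lt]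
  refine ⟨(lt_ssup hb h0).ne', fun ξ hξ => ?_⟩
  obtain ⟨a, ha, hle⟩ := (lt_ssup_iff hb).1 hξ
  rw [Order.succ_eq_add_one]
  exact (add_le_add_left hle 1).trans_lt (lt_ssup hb (h1 a ha))

/-- Closure under addition and subtraction makes the elements of x in [ρ, ρ+ω₁) exactly the ρ+ξ with
ξ in the trace δ. -/
theorem ssup_inter_Iio_add_omega_one (hb : BddAbove x) (htr : x ∩ Iio (ω_ 1) = Iio δ)
    (hδ : δ < ω_ 1)
    (hx : ∀ a ∈ x, ∀ b ∈ x, a + b ∈ x ∧ a - b ∈ x) (hρ : ρ ∈ x) :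
    ssup (x ∩ Iio (ρ + ω_ 1)) = ρ + δ := by
  have hb' : BddAbove (x ∩ Iio (ρ + ω_ 1)) := hb.mono inter_subset_left
  refine le_antisymm ((ssup_le_iff hb').2 ?_) (le_of_forall_lt fun ξ hξ => ?_)
  · rintro a ⟨ha, haω⟩
    rcases lt_or_ge a ρ with hlt | hle
    · exact hlt.trans_le le_self_add
    · have hmem : a - ρ ∈ x ∩ Iio (ω_ 1) := ⟨(hx a ha ρ hρ).2, by
        rw [mem_Iio, Ordinal.sub_lt_of_le hle]; exact haω⟩
      rw [htr, mem_Iio, Ordinal.sub_lt_of_le hle] at hmem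
      exact hmem
  · rw [lt_ssup_iff hb']
    rcases lt_or_ge ξ ρ with hlt | hle
    · exact ⟨ρ, ⟨hρ, by simpa using omega_pos 1⟩, hlt.le⟩
    · have hmem : ξ - ρ ∈ x ∩ Iio (ω_ 1) := by
        rw [htr, mem_Iio, Ordinal.sub_lt_of_le hle]; exact hξ
      refine ⟨ξ, ⟨?_, hξ.trans (by simpa using hδ)⟩, le_rfl⟩
      rw [← Ordinal.add_sub_cancel_of_le hle]
      exact (hx ρ hρ _ hmem.1).1

end

theorem isStationaryFamily_largeColour (h : IsWeakIndexedSquareSeq κ (ℵ_ 1) Γ idx C)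
    (hκ : κ.IsRegular) (hκ2 : ℵ_ 2 ≤ κ) :
    IsStationaryFamily (Iio κ.ord) (largeColour κ Γ idx C) := by
  have hωκ : ω_ 1 < κ.ord := by
    rw [← ord_aleph, ord_lt_ord]
    refine lt_of_lt_of_le ?_ hκ2
    simp
  have hadd := isPrincipal_add_ord hκ.1
  have hωκ0 : ω < κ.ord := (omega0_le_omega 1).trans_lt hωκ
  refine ⟨fun x hx => hx.1, fun 𝒞 h𝒞 => ?_⟩
  have hinf : (Iio κ.ord).Infinite :=
    (infinite_range_of_injective Nat.cast_injective).mono (s := range ((↑) : ℕ → Ordinal.{u})) <| by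
      rintro _ ⟨n, rfl⟩
      exact (natCast_lt_omega0 n).trans hωκ0
  obtain ⟨G₀, hG₀c, hG₀κ, hG₀⟩ := h𝒞.exists_closedUnder hinf
  by_contra hne
  set G : Finset Ordinal.{u} → Set Ordinal.{u} := fun e => G₀ e ∪ arithOp e ∩ Iio κ.ord
  have hGc : ∀ e, (G e).Countable := fun e =>
    (hG₀c e).union ((countable_arithOp e).mono inter_subset_left)
  have hGκ : ∀ e, G e ⊆ Iio κ.ord := fun e => union_subset (hG₀κ e) inter_subset_right
  have hGω : ∀ e, ∀ a ∈ e, a < ω_ 1 → Iio a ⊆ G e := fun e a ha haω b hb =>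
    Or.inr ⟨Or.inl (Or.inl (Or.inr (mem_biUnion ha ⟨haω, hb⟩))), (hb.trans haω).trans hωκ⟩
  obtain ⟨δ, hδ, hgood⟩ := exists_not_isWinning hκ hκ2 hGc hGω
  have hδ' : δ < (ℵ_ 1).ord := by rwa [ord_aleph]
  -- the colours of closed sets with trace `δ` are at most `δ`
  have key : ∀ x ⊆ Iio κ.ord, x.Countable → ClosedUnder G x → x ∩ Iio (ω_ 1) = Iio δ →
      ssup x ∈ Γ ∧ ∀ ρ ∈ x, ρ + δ ∈ Γ ∧ Rel idx C δ (ρ + δ) (ssup x) := by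
    intro x hxκ hxc hx htr
    have hb : BddAbove x := ⟨κ.ord, fun a ha => (hxκ ha).le⟩
    obtain ⟨h0, h1, h2⟩ := arithOp_mem (hx.mono fun e => subset_union_right) hκ hωκ hxκ
    have hxΓ : ssup x ∈ Γ := by
      refine h.mem_of_cof_ne (ssup_lt_ord hκ hxκ ?_)
        (isSuccLimit_ssup hb h0 fun a ha => (h1 a ha).1) ?_
      · refine (le_aleph0_iff_set_countable.2 hxc).trans_lt ?_
        rw [aleph0_lt_lift]
        refine lt_of_lt_of_le ?_ hκ2
        simp
      · refine ((cof_ssup_le_aleph0 hxc).trans_lt ?_).ne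
        simp
    have hδlim : Order.IsSuccLimit δ := by
      have : Iio δ = x ∩ Iio (ω_ 1) := htr.symm
      have hlim : Order.IsSuccLimit (ω_ 1 : Ordinal.{u}) := isSuccLimit_omega 1
      have hδ0 : 0 ∈ Iio δ := by rw [this]; exact ⟨h0, hlim.bot_lt⟩
      rw [Ordinal.isSuccLimit_iff, Order.isSuccPrelimit_iff_succ_lt]
      refine ⟨ne_of_gt hδ0, fun ξ hξ => ?_⟩
      have hξ' : ξ ∈ x ∩ Iio (ω_ 1) := by rw [htr]; exact hξ
      have : Order.succ ξ ∈ x ∩ Iio (ω_ 1) :=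
        ⟨by rw [Order.succ_eq_add_one]; exact (h1 ξ hξ'.1).1, hlim.succ_lt hξ'.2⟩
      rwa [htr] at this
    refine ⟨hxΓ, fun ρ hρ => ?_⟩
    have hs := ssup_inter_Iio_add_omega_one hb htr hδ h2 hρ
    have hρΓ : ρ + δ ∈ Γ := by
      refine h.mem_of_cof_ne (hadd (hxκ hρ) (hδ.trans hωκ)) (isSuccLimit_add _ hδlim) ?_
      rw [cof_add _ hδlim.ne_bot, cof_eq_aleph0_of_isSuccLimit hδlim hδ]
      simp [← aleph_zero]
    refine ⟨hρΓ, ?_⟩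
    by_contra hn
    -- A larger colour would put x into the family, with witness γ = ρ + ω₁, although x belongs to
    -- the club 𝒞.
    refine hne ⟨x, ⟨mem_countableSubsets.2 ⟨hxκ, hxc, ?_⟩, δ, hδ, htr, hxΓ, ρ + ω_ 1,
      (h1 ρ hρ).2, ?_, by rwa [hs], by rwa [hs]⟩, hG₀ x hxκ hxc (hx.mono fun e => subset_union_left)⟩
    · intro hfin
      obtain ⟨m, hm, hmax⟩ := hfin.exists_maximal ⟨0, h0⟩
      have := hmax (h1 m hm).1 le_self_add
      simp at this
    · rw [cof_add _ (omega_pos 1).ne', isRegular_aleph_one.cof_omega_eq]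
  -- This set is unbounded because the empty position is not won, and c is at most δ on its pairs by
  -- comparison with a common supremum.
  let A : Set Ordinal.{u} := {α | ∃ ρ < κ.ord, α = ρ + δ ∧ ¬ ∃ σ, IsWinning κ G δ {ρ} σ}
  have pair := fun ρ ρ' (hρ : ρ < κ.ord) (hρ' : ρ' < κ.ord)
    (hg : ¬ ∃ σ, IsWinning κ G δ {ρ} σ) (hg' : ¬ ∃ σ, IsWinning κ G δ {ρ'} σ) =>
    exists_closedUnder_pair hκ hκ2 hGc hGκ hδ hg (by simpa using hρ) (countable_singleton _) hg'
      (by simpa using hρ') (countable_singleton _)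
  refine h.not_forall_rel hδ' (A := A) ?_ (fun ξ hξ => ?_) ?_
  · rintro _ ⟨ρ, hρ, rfl, hg⟩
    obtain ⟨x, -, hρx, -, hxκ, -, hxc, -, hx, -, htr, -⟩ := pair ρ ρ hρ hρ hg hg
    exact ((key x hxκ hxc hx htr).2 ρ (hρx rfl)).1
  · obtain ⟨ρ, h1, h2, h3⟩ := exists_not_isWinning_insert hgood hξ
    exact ⟨ρ + δ, ⟨ρ, h2, rfl, by simpa using h3⟩, h1.trans_le le_self_add⟩
  · rintro _ ⟨ρ, hρ, rfl, hg⟩ _ ⟨ρ', hρ', rfl, hg'⟩ hlt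
    obtain ⟨x, y, hρx, hρy, hxκ, hyκ, hxc, hyc, hx, hy, htrx, htry, heq⟩ :=
      pair ρ ρ' hρ hρ' hg hg'
    obtain ⟨hxΓ, hx'⟩ := key x hxκ hxc hx htrx
    obtain ⟨-, hy'⟩ := key y hyκ hyc hy htry
    have h2 := (hy' ρ' (hρy rfl)).2
    rw [← heq] at h2
    exact h2.of_rel h hxΓ hδ' (hx' ρ (hρx rfl)).2 hlt

end IsWeakIndexedSquareSeq

theorem SSR.not_weakIndexedSquare (hSSR : SSR.{u}) {κ : Cardinal.{u}} (hκ : κ.IsRegular)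
    (hκ2 : ℵ_ 2 ≤ κ) : ¬ WeakIndexedSquare κ (ℵ_ 1) := by
  rintro ⟨Γ, idx, C, h⟩
  obtain ⟨W, hWκ, hW, hωW, hS⟩ := hSSR κ hκ hκ2 _ (h.isStationaryFamily_largeColour hκ hκ2)
    fun x hx y hy hxy => IsWeakIndexedSquareSeq.largeColour_upward hx hy hxy
  exact h.not_reflects_largeColour hκ hκ2 hWκ hW hωW hS

/-! ### Projective stationary sets and the strong reflection principle -/

section StrongReflection

theorem countable_Iio_subtype (α : Iio (ω_ 1 : Ordinal.{u})) : (Iio α).Countable :=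
  ((countable_Iio_of_lt_omega_one α.2).preimage Subtype.val_injective).mono fun _ h => h

theorem not_countable_univ_Iio : ¬ (univ : Set (Iio (ω_ 1 : Ordinal.{u}))).Countable := by
  rw [← le_aleph0_iff_set_countable, mk_univ, mk_Iio_omega_one, not_le]
  simp

/-- A stationary subset of `ω₁` is stationary as a family of countable initial segments. -/
theorem IsStationary.opStationary {T : Set (Iio (ω_ 1 : Ordinal.{u}))} (hT : IsStationary T) :
    OpStationary {y | ∃ α ∈ T, y = Iio α} := by
  intro G hG
  have hclub : IsClub {δ : Iio (ω_ 1 : Ordinal.{u}) | ClosedUnder G (Iio δ)} := by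
    refine ⟨fun t ht hne _ x hx e he => ?_, fun α => ?_⟩
    · obtain ⟨y, hy, hey⟩ : ∃ y ∈ t, (e : Set _) ⊆ Iio y := by
        rcases e.eq_empty_or_nonempty with rfl | hene
        · exact ⟨_, hne.some_mem, by simp⟩
        · obtain ⟨y, hy, hlt⟩ := (lt_isLUB_iff hx).1 (he (e.max'_mem hene))
          exact ⟨y, hy, fun a ha => (e.le_max' a ha).trans_lt hlt⟩
      exact (ht hy e hey).trans (Iio_subset_Iio (hx.1 hy))
    · have hGc : ∀ e : Finset (Iio (ω_ 1 : Ordinal.{u})), (G e ∪ ⋃ a ∈ e, Iio a).Countable :=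
        fun e => (hG e).union (e.countable_toSet.biUnion fun a _ => countable_Iio_subtype a)
      set x := opClosure (fun e => G e ∪ ⋃ a ∈ e, Iio a) {α} with hx
      have hcl : ClosedUnder (fun e => G e ∪ ⋃ a ∈ e, Iio a) x := closedUnder_opClosure
      have hlow : ∀ a ∈ x, Iio a ⊆ x := fun a ha b hb =>
        hcl {a} (by simpa using ha) (Or.inr (by simpa using hb))
      obtain ⟨δ, hδ, h⟩ := exists_inter_Iio_omega_one (x := Subtype.val '' x)
        (((countable_singleton α).opClosure hGc).image _) (by
          rintro _ ⟨a, ha, rfl⟩ - b hb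
          exact ⟨⟨b, mem_Iio.2 (lt_trans (mem_Iio.1 hb) (mem_Iio.1 a.2))⟩, hlow a ha hb, rfl⟩)
      have hxδ : x = Iio ⟨δ, hδ⟩ := by
        ext a
        have : a.1 ∈ Subtype.val '' x ∩ Iio (ω_ 1) ↔ a.1 ∈ Iio δ := by rw [h]
        rw [mem_inter_iff, Subtype.val_injective.mem_set_image] at this
        exact ⟨fun ha => this.1 ⟨ha, a.2⟩, fun ha => (this.2 ha).1⟩
      refine ⟨⟨δ, hδ⟩, ?_, ?_⟩
      · change ClosedUnder G (Iio ⟨δ, hδ⟩)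
        rw [← hxδ]
        exact hcl.mono fun e => subset_union_left
      · have : α ∈ x := subset_opClosure rfl
        rw [hxδ] at this
        exact le_of_lt this
  obtain ⟨α, hα, hαG⟩ := hT hclub
  exact ⟨Iio α, ⟨α, hα, rfl⟩, countable_Iio_subtype α, hαG⟩

variable {X : Type u} {o : Iio (ω_ 1 : Ordinal.{u}) → X} {𝒮 : Set (Set X)}

/-- The family `𝒮` is projective stationary, with respect to the copy `o` of `ω₁` in `X`. -/
structure ProjectiveStationary (o : Iio (ω_ 1 : Ordinal.{u}) → X) (𝒮 : Set (Set X)) : Prop where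
  injective : Function.Injective o
  countable : ∀ N ∈ 𝒮, N.Countable
  isLowerSet : ∀ N ∈ 𝒮, IsLowerSet (o ⁻¹' N)
  opStationary : ∀ T : Set (Iio (ω_ 1 : Ordinal.{u})), IsStationary T →
    OpStationary {N | N ∈ 𝒮 ∧ ∃ α ∈ T, o ⁻¹' N = Iio α}

/-- Closed bounded chains of members of `𝒮`. -/
structure ClosedChain (o : Iio (ω_ 1 : Ordinal.{u}) → X) (𝒮 : Set (Set X)) : Type u where
  carrier : Set (Set X)
  nonempty : carrier.Nonempty
  subset : carrier ⊆ 𝒮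
  subset_of_trace : ∀ N ∈ carrier, ∀ M ∈ carrier, o ⁻¹' N ⊆ o ⁻¹' M → N ⊆ M
  sUnion_mem : ∀ c ⊆ carrier, c.Nonempty → ⋃₀ c ∈ carrier

namespace ClosedChain

/-- The largest element of a closed chain. -/
def top (p : ClosedChain o 𝒮) : Set X := ⋃₀ p.carrier

theorem top_mem (p : ClosedChain o 𝒮) : p.top ∈ p.carrier :=
  p.sUnion_mem _ subset_rfl p.nonempty

theorem subset_top {p : ClosedChain o 𝒮} {N : Set X} (h : N ∈ p.carrier) : N ⊆ p.top :=
  subset_sUnion_of_mem h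

/-- Closed chains are ordered by end-extension. -/
instance : Preorder (ClosedChain o 𝒮) where
  le p q := q.carrier ⊆ p.carrier ∧ ∀ N ∈ p.carrier, N ⊆ q.top → N ∈ q.carrier
  le_refl p := ⟨subset_rfl, fun _ h _ => h⟩
  le_trans p q r hpq hqr := ⟨hqr.1.trans hpq.1, fun N hN hNr =>
    hqr.2 N (hpq.2 N hN (hNr.trans (subset_top (hqr.1 r.top_mem)))) hNr⟩

theorem top_subset_top {p q : ClosedChain o 𝒮} (h : p ≤ q) : q.top ⊆ p.top :=
  subset_top (h.1 q.top_mem)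

theorem total (h : ProjectiveStationary o 𝒮) (p : ClosedChain o 𝒮) {N M : Set X}
    (hN : N ∈ p.carrier) (hM : M ∈ p.carrier) : N ⊆ M ∨ M ⊆ N :=
  ((h.isLowerSet N (p.subset hN)).total (h.isLowerSet M (p.subset hM))).imp
    (p.subset_of_trace N hN M hM) (p.subset_of_trace M hM N hN)

theorem exists_mem_superset (h : ProjectiveStationary o 𝒮) {s : Set X} (hs : s.Countable) :
    ∃ N ∈ 𝒮, s ⊆ N := by
  have : Nonempty (Iio (ω_ 1 : Ordinal.{u})) := ⟨⟨0, omega_pos 1⟩⟩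
  obtain ⟨N, hN, -, hcl⟩ := h.opStationary univ .univ (fun _ => s) fun _ => hs
  exact ⟨N, hN.1, hcl ∅ (by simp)⟩

theorem nonempty_closedChain (h : ProjectiveStationary o 𝒮) : Nonempty (ClosedChain o 𝒮) := by
  obtain ⟨N, hN, -⟩ := exists_mem_superset h countable_empty
  refine ⟨⟨{N}, singleton_nonempty N, by simpa using hN, ?_, ?_⟩⟩
  · rintro _ rfl _ rfl -
    rfl
  · rintro c hc hne
    rw [hne.subset_singleton_iff.1 hc]
    simp

theorem exists_le_mem_top (h : ProjectiveStationary o 𝒮) (p : ClosedChain o 𝒮) (ξ : X) :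
    ∃ q ≤ p, ξ ∈ q.top := by
  have htop := h.countable _ (p.subset p.top_mem)
  -- Including this β in the new largest element makes its trace strictly larger than all earlier
  -- ones, so the new condition is an end-extension.
  obtain ⟨β, hβ⟩ : ∃ β, o β ∉ p.top := by
    by_contra! hn
    exact not_countable_univ_Iio ((htop.preimage h.injective).mono fun β _ => hn β)
  obtain ⟨N, hN, hsub⟩ := exists_mem_superset h (s := {ξ, o β} ∪ p.top)
    ((by simp : Set.Countable _).union htop)
  have htopN : p.top ⊆ N := subset_union_right.trans hsub
  have hβN : o β ∈ N := hsub (by simp)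
  refine ⟨⟨insert N p.carrier, insert_nonempty _ _, insert_subset hN p.subset, ?_, ?_⟩,
    ⟨subset_insert _ _, ?_⟩, N, mem_insert _ _, hsub (by simp)⟩
  · rintro M (rfl | hM) M' (rfl | hM') htr
    · rfl
    · exact (hβ (subset_top hM' (htr hβN))).elim
    · exact (subset_top hM).trans htopN
    · exact p.subset_of_trace M hM M' hM' htr
  · intro c hc hne
    by_cases hNc : N ∈ c
    · left
      refine Subset.antisymm (sUnion_subset fun M hM => ?_) (subset_sUnion_of_mem hNc)
      rcases hc hM with rfl | hM
      exacts [subset_rfl, (subset_top hM).trans htopN]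
    · exact Or.inr (p.sUnion_mem c (fun M hM =>
        (hc hM).resolve_left fun hMN => hNc (hMN ▸ hM)) hne)
  · rintro M (rfl | hM) hMtop
    exacts [(hβ (hMtop hβN)).elim, hM]

/-- A descending sequence of closed chains has a lower bound with largest element `N` if `N` is
the union of the largest elements of the chains. -/
theorem exists_lowerBound (h : ProjectiveStationary o 𝒮) {p : ℕ → ClosedChain o 𝒮}
    (hp : Antitone p) (hN : (⋃ n, (p n).top) ∈ 𝒮) : ∃ q, ∀ n, q ≤ p n := by
  set N := ⋃ n, (p n).top with hNdef
  have htop : ∀ n, (p n).top ⊆ N := subset_iUnion fun n => (p n).top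
  have hcm : Monotone fun n => (p n).carrier := fun m n hmn => (hp hmn).1
  have hbig : ∀ n, ∀ M ∈ (p n).carrier, o ⁻¹' N ⊆ o ⁻¹' M → N ⊆ M := fun n M hM htr => by
    refine iUnion_subset fun m => ?_
    refine (top_subset_top (hp (le_max_left m n))).trans ?_
    refine (p (max m n)).subset_of_trace _ (top_mem _) M (hcm (le_max_right m n) hM) ?_
    exact (preimage_mono (htop _)).trans htr
  refine ⟨⟨insert N (⋃ n, (p n).carrier), insert_nonempty _ _, insert_subset hN
    (iUnion_subset fun n => (p n).subset), ?_, ?_⟩, fun n => ⟨?_, ?_⟩⟩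
  · rintro M (rfl | hM) M' (rfl | hM') htr
    · rfl
    · obtain ⟨n, hM'⟩ := mem_iUnion.1 hM'
      exact hbig n M' hM' htr
    · obtain ⟨n, hM⟩ := mem_iUnion.1 hM
      exact (subset_top hM).trans (htop n)
    · obtain ⟨m, hM⟩ := mem_iUnion.1 hM
      obtain ⟨n, hM'⟩ := mem_iUnion.1 hM'
      exact (p (max m n)).subset_of_trace M (hcm (le_max_left m n) hM) M'
        (hcm (le_max_right m n) hM') htr
  · intro c hc hne
    have hcN : ⋃₀ c ⊆ N := sUnion_subset fun M hM => by
      rcases hc hM with rfl | hM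
      · rfl
      · obtain ⟨n, hM⟩ := mem_iUnion.1 hM
        exact (subset_top hM).trans (htop n)
    -- A subfamily contained in no single chain has members above every `(p n).top`, by
    -- end-extension, so its union is N.
    by_cases hcn : ∃ n, c ⊆ (p n).carrier
    · obtain ⟨n, hcn⟩ := hcn
      exact Or.inr (mem_iUnion.2 ⟨n, (p n).sUnion_mem c hcn hne⟩)
    · left
      push Not at hcn
      refine Subset.antisymm hcN (iUnion_subset fun n => ?_)
      obtain ⟨M, hM, hMn⟩ := not_subset.1 (hcn n)
      refine Subset.trans ?_ (subset_sUnion_of_mem hM)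
      rcases hc hM with rfl | hM
      · exact htop n
      · obtain ⟨m, hM⟩ := mem_iUnion.1 hM
        have hM' := hcm (le_max_right n m) hM
        refine ((p (max n m)).total h hM' (hcm (le_max_left n m) (p n).top_mem)).resolve_left ?_
        exact fun hsub => hMn ((hp (le_max_left n m)).2 M hM' hsub)
  · exact (subset_iUnion (fun n => (p n).carrier) n).trans (subset_insert _ _)
  · rintro M (rfl | hM) hMn
    · rw [hMn.antisymm (htop n)]
      exact top_mem _
    · obtain ⟨m, hM⟩ := mem_iUnion.1 hM
      exact (hp (le_max_left n m)).2 M (hcm (le_max_right n m) hM) hMn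

/-- Projective stationarity gives a countable M, closed under extending conditions, whose part N in
X lies in 𝒮 and has trace α ∈ T. A descending sequence of conditions in M whose largest elements
exhaust N has a lower bound, and this forces the club name to be unbounded in α, hence to contain α.
-/
theorem preservesStationary (h : ProjectiveStationary o 𝒮) :
    PreservesStationary (ClosedChain o 𝒮) := by
  classical
  intro T hT p A hA
  have hunb : ∀ (r : ClosedChain o 𝒮) (ξ : X) (α : Iio (ω_ 1 : Ordinal.{u})),
      ∃ r' β, r ≤ p → r' ≤ r ∧ ξ ∈ r'.top ∧ α < β ∧ ForcesMem r' β A := fun r ξ α => by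
    by_cases hr : r ≤ p
    · obtain ⟨r₁, h1, hξ⟩ := exists_le_mem_top h r ξ
      obtain ⟨r₂, h2, β, h3, h4⟩ := hA.unbounded α r₁ (h1.trans hr)
      exact ⟨r₂, β, fun _ => ⟨h2.trans h1, top_subset_top h2 hξ, h3, h4⟩⟩
    · exact ⟨r, α, fun hr' => (hr hr').elim⟩
  choose f β hf using hunb
  let z : Iio (ω_ 1 : Ordinal.{u}) := ⟨0, omega_pos 1⟩
  let F : Finset (X ⊕ ClosedChain o 𝒮) → Set (X ⊕ ClosedChain o 𝒮) := fun e =>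
    {Sum.inl (o z), Sum.inr p} ∪
      (⋃ r ∈ Sum.inr ⁻¹' (e : Set (X ⊕ ClosedChain o 𝒮)), Sum.inl '' r.top) ∪
      ⋃ r ∈ Sum.inr ⁻¹' (e : Set (X ⊕ ClosedChain o 𝒮)),
        ⋃ ξ ∈ Sum.inl ⁻¹' (e : Set (X ⊕ ClosedChain o 𝒮)),
          ⋃ α ∈ (Sum.inl ∘ o) ⁻¹' (e : Set (X ⊕ ClosedChain o 𝒮)),
            {Sum.inr (f r ξ α), Sum.inl (o (β r ξ α))}
  have hF : ∀ e, (F e).Countable := fun e => by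
    have h1 := e.countable_toSet.preimage (Sum.inr_injective (α := X) (β := ClosedChain o 𝒮))
    have h2 := e.countable_toSet.preimage (Sum.inl_injective (α := X) (β := ClosedChain o 𝒮))
    have h3 := e.countable_toSet.preimage
      ((Sum.inl_injective (α := X) (β := ClosedChain o 𝒮)).comp h.injective)
    refine ((by simp : Set.Countable _).union (h1.biUnion fun r _ =>
      (h.countable _ (r.subset r.top_mem)).image _)).union ?_
    exact h1.biUnion fun r _ => h2.biUnion fun ξ _ => h3.biUnion fun α _ => by simp
  obtain ⟨M, ⟨hNS, α, hαT, htr⟩, hMc, hM⟩ :=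
    (h.opStationary T hT).preimage (Sum.inl_injective (β := ClosedChain o 𝒮)) F hF
  set N : Set X := Sum.inl ⁻¹' M with hN
  have hpM : Sum.inr p ∈ M := hM ∅ (by simp) (by simp [F])
  have hzN : o z ∈ N := hM ∅ (by simp) (by simp [F])
  have htopM : ∀ r, Sum.inr r ∈ M → r.top ⊆ N := fun r hr ξ hξ => by
    refine hM {Sum.inr r} (by simpa using hr) (Or.inl (Or.inr ?_))
    exact mem_biUnion (show r ∈ _ by simp) (mem_image_of_mem _ hξ)
  have hfM : ∀ r ξ γ, Sum.inr r ∈ M → ξ ∈ N → o γ ∈ N →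
      Sum.inr (f r ξ γ) ∈ M ∧ o (β r ξ γ) ∈ N := fun r ξ γ hr hξ hγ => by
    let e : Finset (X ⊕ ClosedChain o 𝒮) := {Sum.inr r, Sum.inl ξ, Sum.inl (o γ)}
    have hsub : (e : Set (X ⊕ ClosedChain o 𝒮)) ⊆ M := by
      simpa [e, insert_subset_iff] using ⟨hr, hξ, hγ⟩
    have hmem : ({Sum.inr (f r ξ γ), Sum.inl (o (β r ξ γ))} : Set (X ⊕ ClosedChain o 𝒮)) ⊆ M := by
      refine Subset.trans (fun a ha => Or.inr ?_) (hM e hsub)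
      exact mem_biUnion (show r ∈ _ by simp [e]) (mem_biUnion (show ξ ∈ _ by simp [e])
        (mem_biUnion (show γ ∈ _ by simp [e]) ha))
    exact ⟨hmem (by simp), hmem (by simp)⟩
  have hNc : N.Countable := hMc.preimage Sum.inl_injective
  -- The enumeration handles two tasks together: absorbing each point of N into a largest element,
  -- and forcing a club point above each ordinal below α.
  obtain ⟨g, hg⟩ := (hNc.prod (hNc.preimage h.injective)).exists_eq_range ⟨(o z, z), hzN, hzN⟩
  have hgN : ∀ n, (g n).1 ∈ N ∧ o (g n).2 ∈ N := fun n => by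
    have : g n ∈ N ×ˢ (o ⁻¹' N) := hg ▸ mem_range_self n
    exact this
  let P : ℕ → ClosedChain o 𝒮 := Nat.rec p fun n r => f r (g n).1 (g n).2
  have hP : ∀ n, P n ≤ p ∧ Sum.inr (P n) ∈ M := fun n => by
    induction n with
    | zero => exact ⟨le_rfl, hpM⟩
    | succ n ih =>
      exact ⟨(hf (P n) (g n).1 (g n).2 ih.1).1.trans ih.1,
        (hfM (P n) _ _ ih.2 (hgN n).1 (hgN n).2).1⟩
  have hPanti : Antitone P := antitone_nat_of_succ_le fun n => (hf _ _ _ (hP n).1).1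
  have hPN : (⋃ n, (P n).top) = N := by
    refine Subset.antisymm (iUnion_subset fun n => htopM _ (hP n).2) fun ξ hξ => ?_
    obtain ⟨n, hn⟩ : (ξ, z) ∈ range g := hg ▸ mk_mem_prod hξ hzN
    have := (hf (P n) (g n).1 (g n).2 (hP n).1).2.1
    rw [hn] at this
    exact mem_iUnion.2 ⟨n + 1, by simpa only [P, hn] using this⟩
  have hlt : ∀ γ, o γ ∈ N ↔ γ < α := fun γ => by
    rw [← mem_Iio, ← htr]
    rfl
  obtain ⟨q, hq⟩ := exists_lowerBound h hPanti (hPN ▸ hNS)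
  refine ⟨q, hq 0, α, hαT, hA.closed α ⟨?_, fun b hb => ?_⟩ q (hq 0) fun γ hγ q' hq' => ?_⟩
  · exact fun hmin => hmin.not_lt ((hlt z).1 hzN)
  · exact hb.2 (hf p (o z) b le_rfl).2.2.1
      ((hlt _).1 (hfM p (o z) b hpM hzN ((hlt b).2 hb.1)).2)
  · obtain ⟨n, hn⟩ : (o z, γ) ∈ range g := hg ▸ mk_mem_prod hzN ((hlt γ).2 hγ)
    have h1 := (hf (P n) (g n).1 (g n).2 (hP n).1).2.2
    have h2 := (hfM (P n) _ _ (hP n).2 (hgN n).1 (hgN n).2).2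
    refine ⟨q', le_rfl, β (P n) (g n).1 (g n).2, ?_, (hlt _).1 h2, fun r hr => ?_⟩
    · have := h1.1
      rwa [hn] at this ⊢
    · exact h1.2 r (hr.trans (hq'.trans (hq (n + 1))))

/-- Martin's Maximum yields a continuous chain of length `ω₁` through each projective stationary
family. -/
theorem _root_.MartinsMaximum.exists_chain (hMM : MartinsMaximum.{u})
    (h : ProjectiveStationary o 𝒮) :
    ∃ 𝒩 ⊆ 𝒮, (∀ N ∈ 𝒩, ∀ M ∈ 𝒩, o ⁻¹' N ⊆ o ⁻¹' M → N ⊆ M) ∧ (∀ α, ∃ N ∈ 𝒩, o α ∈ N) ∧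
      ∀ c ⊆ 𝒩, c.Nonempty → (∃ α, ∀ N ∈ c, o α ∉ N) → ⋃₀ c ∈ 𝒩 := by
  have := nonempty_closedChain h
  let D : Iio (ω_ 1 : Ordinal.{u}) → Set (ClosedChain o 𝒮) := fun α => {p | o α ∈ p.top}
  obtain ⟨G, hG⟩ := hMM (ClosedChain o 𝒮) (preservesStationary h) (range D) (by
      have := mk_range_le_lift (f := D)
      rw [mk_Iio_omega_one] at this
      simpa [Cardinal.lift_id'] using this) (by
    rintro _ ⟨α, rfl⟩ p
    obtain ⟨q, hq, hα⟩ := exists_le_mem_top h p (o α)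
    exact ⟨q, hα, hq⟩)
  have hdir : ∀ p ∈ G, ∀ q ∈ G, ∃ r ∈ G, r ≤ p ∧ r ≤ q := fun p hp q hq => by
    obtain ⟨r, hr, h1, h2⟩ := G.directed p hp q hq
    exact ⟨r, hr, h1, h2⟩
  refine ⟨{N | ∃ p ∈ G, N ∈ p.carrier}, ?_, ?_, fun α => ?_, ?_⟩
  · rintro N ⟨p, -, hN⟩
    exact p.subset hN
  · rintro N ⟨p, hp, hN⟩ M ⟨q, hq, hM⟩ htr
    obtain ⟨r, -, h1, h2⟩ := hdir p hp q hq
    exact r.subset_of_trace N (h1.1 hN) M (h2.1 hM) htr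
  · obtain ⟨p, hp, hpG⟩ := hG _ (mem_range_self α)
    exact ⟨p.top, ⟨p, hpG, p.top_mem⟩, hp⟩
  · rintro c hc hne ⟨α, hα⟩
    -- A condition whose largest element contains `o α` already contains all of c, since conditions
    -- in G end-extend each other.
    obtain ⟨p, hp, hpG⟩ := hG _ (mem_range_self α)
    refine ⟨p, hpG, p.sUnion_mem c (fun N hN => ?_) hne⟩
    obtain ⟨q, hq, hNq⟩ := hc hN
    obtain ⟨r, -, h1, h2⟩ := hdir p hpG q hq
    refine h1.2 N (h2.1 hNq) ((r.total h (h2.1 hNq) (h1.1 p.top_mem)).resolve_right ?_)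
    exact fun hsub => hα N hN (hsub hp)

end ClosedChain

end StrongReflection

/-! ### Reflection of stationary families under Martin's Maximum -/

section Reflection

variable {L : Type u} {o : Iio (ω_ 1 : Ordinal.{u}) → L} {S : Set (Set L)}

/-- The operations on finite subsets of `L` with countable values. -/
abbrev CountableOp (L : Type u) : Type u :=
  {H : Finset L → Set L // ∀ s, (H s).Countable}

/-- A countable set of elements of `L` and operations on `L` that is closed under its operations
and whose trace on `ω₁` is an initial segment. -/
structure IsModel (o : Iio (ω_ 1 : Ordinal.{u}) → L) (N : Set (L ⊕ CountableOp L)) : Prop where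
  countable : N.Countable
  isLowerSet : IsLowerSet ((Sum.inl ∘ o) ⁻¹' N)
  closed : ∀ H : CountableOp L, Sum.inr H ∈ N → ClosedUnder H.1 (Sum.inl ⁻¹' N)

/-- The operation whose countable closed sets are models. -/
def modelOp (o : Iio (ω_ 1 : Ordinal.{u}) → L) (e : Finset (L ⊕ CountableOp L)) :
    Set (L ⊕ CountableOp L) :=
  (⋃ α ∈ (Sum.inl ∘ o) ⁻¹' (e : Set (L ⊕ CountableOp L)), (Sum.inl ∘ o) '' Iio α) ∪
    ⋃ H ∈ Sum.inr ⁻¹' (e : Set (L ⊕ CountableOp L)),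
      ⋃ s ∈ {s : Finset L | (s : Set L) ⊆ Sum.inl ⁻¹' (e : Set (L ⊕ CountableOp L))},
        Sum.inl '' H.1 s

theorem countable_modelOp (ho : Function.Injective o) (e : Finset (L ⊕ CountableOp L)) :
    (modelOp o e).Countable := by
  have h1 := e.countable_toSet.preimage (Sum.inr_injective (α := L) (β := CountableOp L))
  have h2 := e.countable_toSet.preimage (Sum.inl_injective (α := L) (β := CountableOp L))
  have h3 := e.countable_toSet.preimage
    ((Sum.inl_injective (α := L) (β := CountableOp L)).comp ho)
  exact (h3.biUnion fun α _ => (countable_Iio_subtype α).image _).union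
    (h1.biUnion fun H _ => h2.setOf_finset_subset.biUnion fun s _ => (H.2 s).image _)

theorem ClosedUnder.isModel {N : Set (L ⊕ CountableOp L)} (hc : N.Countable)
    (hN : ClosedUnder (modelOp o) N) : IsModel o N := by
  classical
  refine ⟨hc, fun α β hβα hα => ?_, fun H hH s hs => ?_⟩
  · rcases hβα.eq_or_lt with rfl | hlt
    · exact hα
    · refine hN {Sum.inl (o α)} (by simpa using hα) (Or.inl ?_)
      exact mem_biUnion (show α ∈ _ by simp) (mem_image_of_mem _ hlt)
  · intro a ha
    refine hN (insert (Sum.inr H) (s.image Sum.inl)) ?_ (Or.inr ?_)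
    · rw [Finset.coe_insert, Finset.coe_image]
      exact insert_subset hH (image_subset_iff.2 hs)
    · refine mem_biUnion (show H ∈ _ by simp) (mem_biUnion (show s ∈ _ from ?_)
        (mem_image_of_mem _ ha))
      intro b hb
      simpa using hb

/-- The models whose trace on `L` lies in `S` if that holds for some model that extends them and
has the same trace on `ω₁`. -/
def modelsInIfPossible (o : Iio (ω_ 1 : Ordinal.{u}) → L) (S : Set (Set L)) :
    Set (Set (L ⊕ CountableOp L)) :=
  {N | IsModel o N ∧ (Sum.inl ⁻¹' N ∈ S ∨ ∀ M, IsModel o M → N ⊆ M →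
    (Sum.inl ∘ o) ⁻¹' M = (Sum.inl ∘ o) ⁻¹' N → Sum.inl ⁻¹' M ∉ S)}

/-- Fix a stationary T. If the members of S with trace in T are stationary, they lift to models of
the first kind. Otherwise some operation H closes none of them; a model with trace in T that
contains H is of the second kind, as H passes to its extensions. -/
theorem projectiveStationary_modelsInIfPossible (ho : Function.Injective o) (S : Set (Set L)) :
    ProjectiveStationary (Sum.inl ∘ o) (modelsInIfPossible o S) where
  injective := Sum.inl_injective.comp ho
  countable := fun N hN => hN.1.countable
  isLowerSet := fun N hN => hN.1.isLowerSet
  opStationary := fun T hT G hG => by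
    by_cases hST : OpStationary {y | y ∈ S ∧ ∃ α ∈ T, o ⁻¹' y = Iio α}
    · obtain ⟨M, hM, hMc, hcl⟩ := hST.preimage (Sum.inl_injective (β := CountableOp L))
        (fun e => G e ∪ modelOp o e) fun e => (hG e).union (countable_modelOp ho e)
      have hmod : IsModel o M := (hcl.mono fun e => subset_union_right).isModel hMc
      exact ⟨M, ⟨⟨hmod, Or.inl hM.1⟩, hM.2⟩, hMc, hcl.mono fun e => subset_union_left⟩
    · simp only [OpStationary, not_forall] at hST
      obtain ⟨H, hH, hHS⟩ := hST
      obtain ⟨M, ⟨α, hαT, hα⟩, hMc, hcl⟩ := hT.opStationary.preimage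
        ((Sum.inl_injective (β := CountableOp L)).comp ho)
        (fun e => G e ∪ (modelOp o e ∪ {Sum.inr ⟨H, hH⟩})) fun e => (hG e).union
          ((countable_modelOp ho e).union (countable_singleton _))
      have hmod : IsModel o M :=
        (hcl.mono fun e => subset_union_left.trans subset_union_right).isModel hMc
      refine ⟨M, ⟨⟨hmod, Or.inr fun M' hM' hsub htr hS => hHS ?_⟩, α, hαT, hα⟩, hMc,
        hcl.mono fun e => subset_union_left⟩
      refine ⟨_, ⟨hS, α, hαT, htr.trans hα⟩, hM'.countable.preimage Sum.inl_injective,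
        hM'.closed ⟨H, hH⟩ (hsub (hcl ∅ (by simp) (Or.inr (Or.inr rfl))))⟩

/-- Under Martin's Maximum, each stationary family of countable sets reflects to a set of
cardinality at most `ℵ₁`. -/
theorem MartinsMaximum.exists_reflecting_set (hMM : MartinsMaximum.{u})
    (ho : Function.Injective o) (hS : OpStationary S) :
    ∃ W : Set L, #W ≤ ℵ_ 1 ∧ range o ⊆ W ∧ ∀ G : Finset L → Set L, (∀ e, (G e).Countable) →
      (∀ e, G e ⊆ W) → ∃ y ∈ S, y ⊆ W ∧ ClosedUnder G y := by
  have hps := projectiveStationary_modelsInIfPossible ho S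
  obtain ⟨𝒩, h𝒩, hmono, hcov, hunion⟩ := hMM.exists_chain hps
  have htrc : ∀ N ∈ 𝒩, ((Sum.inl ∘ o) ⁻¹' N).Countable := fun N hN =>
    (hps.countable N (h𝒩 hN)).preimage hps.injective
  have hle : ∀ N ∈ 𝒩, ∀ M ∈ 𝒩, ∀ β, (Sum.inl ∘ o) β ∉ N → (Sum.inl ∘ o) β ∈ M → N ⊆ M :=
    fun N hN M hM β hβN hβM => hmono N hN M hM <|
      ((hps.isLowerSet N (h𝒩 hN)).total (hps.isLowerSet M (h𝒩 hM))).resolve_right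
        fun h => hβN (h hβM)
  choose Q hQ hoQ using hcov
  have hex : ∀ s : Set (Iio (ω_ 1 : Ordinal.{u})), s.Countable → ∃ β, β ∉ s := fun s hs => by
    by_contra! hn
    exact not_countable_univ_Iio (hs.mono fun β _ => hn β)
  set W : Set L := ⋃ β, Sum.inl ⁻¹' Q β with hW
  -- The models on the chain have countable traces, so an index outside the countably many traces
  -- involved gives a model above all of them.
  have hdir : ∀ s ⊆ W, s.Countable → ∃ β, s ⊆ Sum.inl ⁻¹' Q β := fun s hsW hs => by
    have hβ : ∀ a, ∃ β, a ∈ s → Sum.inl a ∈ Q β := fun a => by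
      by_cases ha : a ∈ s
      · obtain ⟨β, hβ⟩ := mem_iUnion.1 (hsW ha)
        exact ⟨β, fun _ => hβ⟩
      · exact ⟨⟨0, omega_pos 1⟩, fun h => (ha h).elim⟩
    choose β hβ using hβ
    obtain ⟨γ, hγ⟩ := hex (⋃ a ∈ s, (Sum.inl ∘ o) ⁻¹' Q (β a))
      (hs.biUnion fun a _ => htrc _ (hQ _))
    refine ⟨γ, fun a ha => hle _ (hQ (β a)) _ (hQ γ) γ (fun h => hγ ?_) (hoQ γ) (hβ a ha)⟩
    exact mem_biUnion ha h
  refine ⟨W, ?_, ?_, fun G hG hGW => ?_⟩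
  · have h1 := mk_iUnion_le_lift fun β => (Sum.inl ⁻¹' Q β : Set L)
    have h2 : (⨆ β, Cardinal.lift.{u + 1} #(Sum.inl ⁻¹' Q β : Set L)) ≤ ℵ₀ := ciSup_le' fun β => by
      rw [lift_le_aleph0, le_aleph0_iff_set_countable]
      exact (hps.countable _ (h𝒩 (hQ β))).preimage Sum.inl_injective
    rw [← hW, mk_Iio_omega_one] at h1
    rw [← Cardinal.lift_le.{u + 1}]
    refine h1.trans ((mul_le_mul_right h2 _).trans ?_)
    rw [Cardinal.mul_eq_left] <;> simp [aleph0_ne_zero]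
  · rintro _ ⟨β, rfl⟩
    exact mem_iUnion.2 ⟨β, hoQ β⟩
  choose b hb using fun e => hdir (G e) (hGW e) (hG e)
  let z : Iio (ω_ 1 : Ordinal.{u}) := ⟨0, omega_pos 1⟩
  -- The set y contains `Q β` for each index β in its trace, and an index b s of a chain member
  -- including G s for each finite s ⊆ y. The point `o z` makes the trace nonempty.
  obtain ⟨y, hyS, hyc, hy⟩ := hS.preimage (Sum.inl_injective (β := CountableOp L)) (fun e =>
      modelOp o e ∪ ({Sum.inl (o z)} ∪
        ((⋃ β ∈ (Sum.inl ∘ o) ⁻¹' (e : Set (L ⊕ CountableOp L)), Q β) ∪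
        (fun s => Sum.inl (o (b s))) ''
          {s : Finset L | (s : Set L) ⊆ Sum.inl ⁻¹' (e : Set (L ⊕ CountableOp L))}))) fun e =>
    (countable_modelOp ho e).union ((countable_singleton _).union
      (((e.countable_toSet.preimage hps.injective).biUnion fun β _ =>
        hps.countable _ (h𝒩 (hQ β))).union
      ((e.countable_toSet.preimage Sum.inl_injective).setOf_finset_subset.image _)))
  have hmod : IsModel o y := (hy.mono fun e => subset_union_left).isModel hyc
  have hzy : Sum.inl (o z) ∈ y := hy ∅ (by simp) (Or.inr (Or.inl rfl))
  have hQy : ∀ β, Sum.inl (o β) ∈ y → Q β ⊆ y := fun β hβ a ha => by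
    refine hy {Sum.inl (o β)} (by simpa using hβ) (Or.inr (Or.inr (Or.inl ?_)))
    exact mem_biUnion (show β ∈ _ by simp) ha
  have hby : ∀ s : Finset L, (s : Set L) ⊆ Sum.inl ⁻¹' y → Sum.inl (o (b s)) ∈ y := fun s hs => by
    classical
    refine hy (s.image Sum.inl) ?_ (Or.inr (Or.inr (Or.inr ⟨s, ?_, rfl⟩)))
    · rw [Finset.coe_image]
      exact image_subset_iff.2 hs
    · intro a ha
      simpa using ha
  set N := ⋃₀ (Q '' {β | Sum.inl (o β) ∈ y}) with hN
  have hNy : N ⊆ y := by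
    rw [hN, sUnion_image]
    exact iUnion₂_subset hQy
  have hQN : ∀ β, Sum.inl (o β) ∈ y → Q β ⊆ N := fun β hβ =>
    subset_sUnion_of_mem (mem_image_of_mem Q hβ)
  obtain ⟨α, hα⟩ := hex _ (hyc.preimage hps.injective)
  have hN𝒩 : N ∈ 𝒩 := by
    refine hunion _ ?_ ⟨_, mem_image_of_mem Q hzy⟩ ⟨α, ?_⟩
    · rintro _ ⟨β, -, rfl⟩
      exact hQ β
    · rintro _ ⟨β, hβ, rfl⟩ hα'
      exact hα (hQy β hβ hα')
  have htr : (Sum.inl ∘ o) ⁻¹' y = (Sum.inl ∘ o) ⁻¹' N :=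
    Subset.antisymm (fun β hβ => hQN β hβ (hoQ β)) (preimage_mono hNy)
  -- The model y extends N with the same trace on ω₁ and its part in L is in S, which excludes the
  -- second alternative for N.
  have hNS : Sum.inl ⁻¹' N ∈ S :=
    (h𝒩 hN𝒩).2.resolve_right fun h => h y hmod hNy htr hyS
  refine ⟨_, hNS, fun a ha => ?_, fun s hs => ?_⟩
  · obtain ⟨_, ⟨β, -, rfl⟩, ha⟩ := ha
    exact mem_iUnion.2 ⟨β, ha⟩
  · exact (hb s).trans (preimage_mono (hQN _ (hby s (hs.trans (preimage_mono hNy)))))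

end Reflection

/-- The ordinals below μ form a type one universe too high for MM, so the reflection takes place on
`μ.ord.ToType` and is transported back along e. -/
theorem MartinsMaximum.ssr (hMM : MartinsMaximum.{u}) : SSR.{u} := by
  classical
  intro μ hμ hμ2 S hS _
  have hωμ : ω_ 1 < μ.ord := by
    rw [← ord_aleph, ord_lt_ord]
    refine lt_of_lt_of_le ?_ hμ2
    simp
  let ι : Iio μ.ord ≃o μ.ord.ToType := ToType.mk
  let e : μ.ord.ToType → Ordinal.{u} := fun l => (ι.symm l).1
  have he : Function.Injective e := Subtype.val_injective.comp ι.symm.injective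
  have heμ : ∀ a < μ.ord, ∃ l, e l = a := fun a ha => ⟨ι ⟨a, ha⟩, by simp [e]⟩
  let o : Iio (ω_ 1 : Ordinal.{u}) → μ.ord.ToType := fun α => ι ⟨α, α.2.trans hωμ⟩
  have heo : ∀ α, e (o α) = α := fun α => by simp [e, o]
  have ho : Function.Injective o := fun α β h => by
    have := congrArg e h
    rw [heo, heo] at this
    exact Subtype.ext this
  have hstat : OpStationary {y : Set μ.ord.ToType | e '' y ∈ S} := fun G hG => by
    obtain ⟨y, hyS, hy⟩ := hS.exists_closedUnder
      (G := fun E => e '' G (E.preimage e he.injOn)) fun E => (hG _).image e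
    have hyX := mem_countableSubsets.1 (hS.1 hyS)
    have hyr : e '' (e ⁻¹' y) = y := image_preimage_eq_of_subset fun a ha => heμ a (hyX.1 ha)
    refine ⟨e ⁻¹' y, by rwa [mem_ofPred_eq, hyr], hyX.2.1.preimage he, fun s hs l hl => ?_⟩
    refine hy (s.image e) ?_ ⟨⟨l, ?_, rfl⟩, (ι.symm l).2⟩
    · rw [Finset.coe_image]
      exact image_subset_iff.2 hs
    · convert hl
      ext a
      simp [he.eq_iff]
  obtain ⟨W, hWc, hoW, hW⟩ := hMM.exists_reflecting_set ho hstat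
  have hωW : Iio (ω_ 1) ⊆ e '' W := fun a ha => ⟨o ⟨a, ha⟩, hoW (mem_range_self _), heo _⟩
  have hWinf : (e '' W).Infinite := by
    refine Infinite.mono (hωW) fun hfin => ?_
    have := hfin.countable
    rw [← le_aleph0_iff_set_countable, mk_Iio_omega_one] at this
    exact absurd this (by simp)
  refine ⟨e '' W, ?_, le_antisymm ?_ ?_, hωW, inter_subset_right, fun 𝒞 h𝒞 => ?_⟩
  · rintro _ ⟨l, -, rfl⟩
    exact (ι.symm l).2
  · have h1 := mk_image_le_lift (f := e) (s := W)
    have h2 : Cardinal.lift.{u + 1} #W ≤ ℵ_ 1 := by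
      rw [← Cardinal.lift_le.{u + 1}] at hWc
      simpa using hWc
    rw [Cardinal.lift_id'.{u, u + 1}] at h1
    exact h1.trans h2
  · rw [← mk_Iio_omega_one]
    exact mk_le_mk_of_subset hωW
  · obtain ⟨G, hGc, hGW, hG⟩ := h𝒞.exists_closedUnder hWinf
    obtain ⟨y, hyS, hyW, hy⟩ := hW (fun s => e ⁻¹' G (s.image e)) (fun s => (hGc _).preimage he)
      fun s l hl => by
        obtain ⟨l', hl', h⟩ := hGW _ hl
        rwa [← he h]
    have hyX := mem_countableSubsets.1 (hS.1 hyS)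
    refine ⟨e '' y, ⟨hyS, mem_countableSubsets.2 ⟨image_mono hyW, hyX.2⟩⟩,
      hG _ (image_mono hyW) hyX.2.1 fun E hE a ha => ?_⟩
    obtain ⟨s, hsy, rfl⟩ := Finset.subset_set_image_iff.1 hE
    obtain ⟨l, -, rfl⟩ := hGW _ ha
    exact mem_image_of_mem e (hy s hsy ha)

theorem mainTheorem2 :
    (SSR.{u} → ∀ κ : Cardinal.{u}, κ.IsRegular → ℵ_ 2 ≤ κ → ¬ WeakIndexedSquare κ (ℵ_ 1)) ∧
    (MartinsMaximum.{u} → SSR.{u}) ∧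
    (MartinsMaximum.{u} →
      ∀ κ : Cardinal.{u}, κ.IsRegular → ℵ_ 1 < κ → ¬ WeakIndexedSquare κ (ℵ_ 1)) := by
  refine ⟨fun h κ hκ hκ2 => h.not_weakIndexedSquare hκ hκ2, fun h => h.ssr, fun h κ hκ hκ1 => ?_⟩
  refine h.ssr.not_weakIndexedSquare hκ ?_
  rw [← one_add_one_eq_two, ← succ_aleph]
  exact Order.succ_le_of_lt hκ1
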